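/- Let $N\ge 1$, let $G\subseteq GL_2(\mathbb Z/N\mathbb Z)$ be a subgroup with normalizer $\mathfrak N(G)$, let $k\in\mathbb Z$, and let $\lambda_N$ denote reduction modulo $N$ of integral $2\times2$ matrices. For a subgroup $H\subseteq GL_2(\mathbb Z/N\mathbb Z)$ put $\Gamma_H=\{\gamma\in SL_2(\mathbb Z):\lambda_N(\gamma)\in H\}$. For $g=\begin{pmatrix}a&b\\c&d\end{pmatrix}\in GL_2^+(\mathbb Q)$ put $f|_g(z)=\det(g)^{k-1}(cz+d)^{-k}f(gz)$. Let $S_k(\Gamma_G)$ be the space of holomorphic cusp forms of weight $k$ for $\Gamma_G$, with the Petersson product $$\langle f,g\rangle=\frac1{V}\int_{\Gamma_G\backslash\mathcal H}f(\tau)\overline{g(\tau)}\,\mathrm{Im}(\tau)^k\,\frac{dx\,dy}{y^2},\qquad V=\int_{\Gamma_G\backslash\mathcal H}\frac{dx\,dy}{y^2}.$$ For $q\in\Gamma_{\mathfrak N(G)}/\Gamma_G$ the diamond operator on $S_k(\Gamma_G)$ is $\langle q\rangle f=f|_\gamma$ for any representative $\gamma\in\Gamma_{\mathfrak N(G)}$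 of $q$. For $\Delta\subseteq GL_2^+(\mathbb Q)$ with $\Gamma_G\Delta=\Delta\Gamma_G=\Delta$ and $\Gamma_G\backslash\Delta$ finite, put $T_\Delta f=\sum_{\alpha\in\Gamma_G\backslash\Delta}f|_\alpha$; write $T_\alpha=T_{\Gamma_G\alpha\Gamma_G}$, and $T_n=T_{\Delta_n}$ with $\Delta_n=\{\alpha\in M_2(\mathbb Z):\det\alpha=n,\ \lambda_N(\alpha)\in G\}$. For an integer $n\geq 1$ we write $n\in\det(G)$ if the class of $n$ modulo $N$ is the determinant of an element of $G$. Theorem. The integrals defining $\langle\cdot,\cdot\rangle$ converge, $V\ne0$, and $\langle\cdot,\cdot\rangle$ is an inner product on $S_k(\Gamma_G)$. With respect to it: 1. For every $q\in\Gamma_{\mathfrak N(G)}/\Gamma_G$, $\langle q\rangle$ is invertible, $\langle q\rangle^*=\langle q\rangle^{-1}$, and $\langle q\rangle$ is normal. 2. Let $p\in\det(G)$ be a prime. There is $\alpha\in M_2(\mathbb Z)$ with $\det\alpha=p$ and $\lambda_N(\alpha)\in G$. For every such $\alpha$ one has $T_\alpha=T_p$; there is $\sigma_p\in\Gamma_{\mathfrak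 N(G)}$ with $\lambda_N(\sigma_p)=p\cdot\lambda_N(\alpha)^{-2}$; and for every such $\sigma_p$ $$T_p^*=\langle\sigma_p\rangle\circ T_p .$$ 3. For every integer $n\ge1$ with $n\in\det(G)$ the operator $T_n$ is normal; and for every $\alpha\in M_2(\mathbb Z)$ with $\det\alpha>0$ and $\lambda_N(\alpha)\in G$ the operator $T_\alpha$ is normal. -/

import Mathlib

open UpperHalfPlane ModularForm Matrix.SpecialLinearGroup MeasureTheory
open scoped MatrixGroups Modular ComplexConjugate

namespace HeckeAdj

noncomputable section

/-! ### Congruence subgroups attached to subgroups of `GL₂(ℤ/N)` -/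

/-- `Γ_G`: the preimage in `SL₂(ℤ)` of a subgroup `G` of `GL₂(ℤ/N)` under reduction mod `N`. -/
def Gam {N : ℕ} (G : Subgroup (GL (Fin 2) (ZMod N))) : Subgroup SL(2, ℤ) :=
  G.comap (mapGL (ZMod N))

/-- The normalizer of `G` in `GL₂(ℤ/N)`. -/
abbrev nrm {N : ℕ} (G : Subgroup (GL (Fin 2) (ZMod N))) : Subgroup (GL (Fin 2) (ZMod N)) :=
  Subgroup.normalizer (G : Set (GL (Fin 2) (ZMod N)))

/-- The reduction map `λ_N : M₂(ℤ) → M₂(ℤ/N)`. -/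
def red (N : ℕ) (A : Matrix (Fin 2) (Fin 2) ℤ) : Matrix (Fin 2) (Fin 2) (ZMod N) :=
  A.map (Int.cast : ℤ → ZMod N)

/-- `λ_N(A) ∈ G`. -/
def RedMem {N : ℕ} (G : Subgroup (GL (Fin 2) (ZMod N))) (A : Matrix (Fin 2) (Fin 2) ℤ) : Prop :=
  ∃ a ∈ G, (a : Matrix (Fin 2) (Fin 2) (ZMod N)) = red N A

/-- `n mod N ∈ det(G)`. -/
def InDet {N : ℕ} (G : Subgroup (GL (Fin 2) (ZMod N))) (n : ℕ) : Prop :=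
  ∃ a ∈ G, (a : Matrix (Fin 2) (Fin 2) (ZMod N)).det = (n : ZMod N)

instance finiteIndex_Gam {N : ℕ} [NeZero N] (G : Subgroup (GL (Fin 2) (ZMod N))) :
    (Gam G).FiniteIndex := by
  have h : (mapGL (ZMod N) : SL(2, ℤ) →* GL (Fin 2) (ZMod N)).ker ≤ Gam G := by
    intro x hx
    rw [MonoidHom.mem_ker] at hx
    rw [Gam, Subgroup.mem_comap, hx]
    exact one_mem G
  have := Subgroup.finiteIndex_ker (mapGL (ZMod N) : SL(2, ℤ) →* GL (Fin 2) (ZMod N))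
  exact Subgroup.finiteIndex_of_le h

/-- The space `S_k(Γ)` of cusp forms. -/
abbrev SCusp (Γ : Subgroup SL(2, ℤ)) (k : ℤ) : Type := CuspForm (Γ : Subgroup (GL (Fin 2) ℝ)) k

/-! ### The Petersson inner product -/

/-- `∫_{X_Γ} φ dμ` for a `Γ`-invariant function `φ` on the upper half-plane, where
`dμ = dx dy / y²`: the images `γ⁻¹𝒟` of the standard fundamental domain `𝒟` of `SL₂(ℤ)`, for `γ`
running over representatives of `SL₂(ℤ) / {±1}Γ`, together form a fundamental domain for `Γ`. -/
def integralX (Γ : Subgroup SL(2, ℤ)) (φ : ℍ → ℂ) : ℂ :=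
  ∑ᶠ q : SL(2, ℤ) ⧸ (Γ ⊔ Subgroup.zpowers (-1)), ∫ τ in 𝒟, φ ((q.out)⁻¹ • τ)

/-- The integrand `f(τ) conj(g(τ)) Im(τ)^k` of the Petersson inner product. -/
def integrand (k : ℤ) (f g : ℍ → ℂ) (τ : ℍ) : ℂ :=
  f τ * conj (g τ) * (τ.im : ℂ) ^ k

/-- The volume `V_Γ` of `X_Γ`. -/
def vol (Γ : Subgroup SL(2, ℤ)) : ℂ := integralX Γ fun _ => 1

/-- The Petersson inner product on `S_k(Γ)`, linear in `f` and conjugate linear in `g`. -/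
def peterssonInner (Γ : Subgroup SL(2, ℤ)) (k : ℤ) (f g : SCusp Γ k) : ℂ :=
  (vol Γ)⁻¹ * integralX Γ (integrand k f g)

/-- `T'` is the adjoint of `T` for the Petersson inner product. -/
def IsAdjoint (Γ : Subgroup SL(2, ℤ)) (k : ℤ) (T T' : SCusp Γ k →ₗ[ℂ] SCusp Γ k) : Prop :=
  ∀ f g : SCusp Γ k, peterssonInner Γ k (T f) g = peterssonInner Γ k f (T' g)

/-- `T` is normal: it has an adjoint for the Petersson inner product and commutes with it. -/
def IsNormalOp (Γ : Subgroup SL(2, ℤ)) (k : ℤ) (T : SCusp Γ k →ₗ[ℂ] SCusp Γ k) : Prop :=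
  ∃ T' : SCusp Γ k →ₗ[ℂ] SCusp Γ k, IsAdjoint Γ k T T' ∧ T ∘ₗ T' = T' ∘ₗ T

/-! ### Hecke operators -/

/-- `GL₂(ℚ) → GL₂(ℝ)`. -/
abbrev toR (g : GL (Fin 2) ℚ) : GL (Fin 2) ℝ := Matrix.GeneralLinearGroup.map (Rat.castHom ℝ) g

/-- The class of `g` in `Γ \ GL₂(ℚ)`. -/
abbrev rcoset (Γ : Subgroup SL(2, ℤ)) (g : GL (Fin 2) ℚ) :
    Quotient (QuotientGroup.rightRel (Γ.map (mapGL ℚ))) :=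
  Quotient.mk _ g

/-- `Δ ⊆ GL₂⁺(ℚ)` with `ΓΔ = ΔΓ = Δ` and `Γ \ Δ` finite. -/
structure IsHeckeSet (Γ : Subgroup SL(2, ℤ)) (Δ : Set (GL (Fin 2) ℚ)) : Prop where
  det_pos : ∀ g ∈ Δ, 0 < (g : Matrix (Fin 2) (Fin 2) ℚ).det
  mul_left : ∀ γ ∈ Γ, ∀ g ∈ Δ, mapGL ℚ γ * g ∈ Δ
  mul_right : ∀ γ ∈ Γ, ∀ g ∈ Δ, g * mapGL ℚ γ ∈ Δ
  finite : (rcoset Γ '' Δ).Finite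

lemma toR_mapGL (γ : SL(2, ℤ)) : toR (mapGL ℚ γ) = mapGL ℝ γ := by
  ext i j; simp [toR]

lemma det_toR (g : GL (Fin 2) ℚ) :
    ((toR g : GL (Fin 2) ℝ) : Matrix (Fin 2) (Fin 2) ℝ).det
      = ((g : Matrix (Fin 2) (Fin 2) ℚ).det : ℝ) := by
  simp [toR, Matrix.det_fin_two]

lemma slash_eq_of_rcoset {Γ : Subgroup SL(2, ℤ)} {k : ℤ} (f : SCusp Γ k) {g h : GL (Fin 2) ℚ}
    (e : rcoset Γ g = rcoset Γ h) : (f : ℍ → ℂ) ∣[k] toR g = (f : ℍ → ℂ) ∣[k] toR h := by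
  have e' := Quotient.exact e
  rw [← Quotient.eq_iff_equiv, Quotient.eq, QuotientGroup.rightRel_apply] at e'
  obtain ⟨γ, hγ, hγ'⟩ := e'
  have : h = mapGL ℚ γ * g := by rw [hγ']; simp
  rw [this, show toR (mapGL ℚ γ * g) = toR (mapGL ℚ γ) * toR g from map_mul _ _ _,
    SlashAction.slash_mul]
  congr 1
  have h2 := SlashInvariantFormClass.slash_action_eq f (mapGL ℝ γ) ⟨γ, hγ, rfl⟩
  rw [← toR_mapGL] at h2
  exact h2.symm

lemma out_mem {Γ : Subgroup SL(2, ℤ)} {Δ : Set (GL (Fin 2) ℚ)} (hΔ : IsHeckeSet Γ Δ)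
    {c} (hc : c ∈ rcoset Γ '' Δ) : c.out ∈ Δ := by
  obtain ⟨g, hg, rfl⟩ := hc
  have e := Quotient.mk_out (s := QuotientGroup.rightRel (Γ.map (mapGL ℚ))) g
  rw [QuotientGroup.rightRel_apply] at e
  obtain ⟨γ, hγ, hγ'⟩ := e
  have : (rcoset Γ g).out = mapGL ℚ γ⁻¹ * g := by rw [map_inv, hγ']; simp
  rw [this]
  exact hΔ.mul_left _ (inv_mem hγ) _ hg

/-- `T_Δ f = ∑_{α ∈ Γ\Δ} f|α`, as a function on the upper half-plane. -/
def heckeFun {Γ : Subgroup SL(2, ℤ)} {Δ : Set (GL (Fin 2) ℚ)} (hΔ : IsHeckeSet Γ Δ) (k : ℤ)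
    (f : ℍ → ℂ) : ℍ → ℂ :=
  ∑ c ∈ hΔ.finite.toFinset, f ∣[k] toR c.out

lemma heckeFun_slash {Γ : Subgroup SL(2, ℤ)} {Δ : Set (GL (Fin 2) ℚ)} (hΔ : IsHeckeSet Γ Δ)
    {k : ℤ} (f : SCusp Γ k) {γ : SL(2, ℤ)} (hγ : γ ∈ Γ) :
    (heckeFun hΔ k f) ∣[k] (mapGL ℝ γ) = heckeFun hΔ k f := by
  rw [heckeFun, SlashAction.sum_slash]
  have key : ∀ c : Quotient (QuotientGroup.rightRel (Γ.map (mapGL ℚ))), ∀ δ ∈ Γ,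
      c ∈ rcoset Γ '' Δ → rcoset Γ (c.out * mapGL ℚ δ) ∈ rcoset Γ '' Δ :=
    fun c δ hδ hc => ⟨_, hΔ.mul_right δ hδ _ (out_mem hΔ hc), rfl⟩
  have out_mul : ∀ g : GL (Fin 2) ℚ, ∀ δ : SL(2, ℤ),
      rcoset Γ ((rcoset Γ g).out * mapGL ℚ δ) = rcoset Γ (g * mapGL ℚ δ) := by
    intro g δ
    have e := Quotient.mk_out (s := QuotientGroup.rightRel (Γ.map (mapGL ℚ))) g
    rw [QuotientGroup.rightRel_apply] at e
    apply Quotient.sound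
    rw [← Quotient.eq_iff_equiv, Quotient.eq, QuotientGroup.rightRel_apply]
    simpa [mul_assoc] using e
  refine Finset.sum_bij' (fun c _ => rcoset Γ (c.out * mapGL ℚ γ))
    (fun c _ => rcoset Γ (c.out * mapGL ℚ γ⁻¹)) ?_ ?_ ?_ ?_ ?_
  · intro c hc
    simp only [Set.Finite.mem_toFinset] at hc ⊢
    exact key c γ hγ hc
  · intro c hc
    simp only [Set.Finite.mem_toFinset] at hc ⊢
    exact key c _ (inv_mem hγ) hc
  · intro c _
    rw [out_mul, map_inv, mul_inv_cancel_right]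
    exact Quotient.out_eq c
  · intro c _
    rw [out_mul, map_inv, inv_mul_cancel_right]
    exact Quotient.out_eq c
  · intro c _
    rw [← SlashAction.slash_mul, ← toR_mapGL, ← map_mul]
    exact slash_eq_of_rcoset f (Quotient.out_eq (rcoset Γ (c.out * mapGL ℚ γ))).symm

lemma isZeroAt_slash {Γ : Subgroup SL(2, ℤ)} [Γ.FiniteIndex] {k : ℤ} (f : SCusp Γ k)
    (g : GL (Fin 2) ℚ) {c : OnePoint ℝ} (hc : IsCusp c (Γ : Subgroup (GL (Fin 2) ℝ))) :
    c.IsZeroAt ((f : ℍ → ℂ) ∣[k] toR g) k := by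
  have h := (CuspForm.translate f (toR g)).zero_at_cusps' (c := c)
  have ar := Subgroup.IsArithmetic.conj (Γ : Subgroup (GL (Fin 2) ℝ)) g⁻¹
  rw [show (Matrix.GeneralLinearGroup.map (Rat.castHom ℝ) g⁻¹) = (toR g)⁻¹ from map_inv _ _] at ar
  refine h ?_
  rw [Subgroup.IsArithmetic.isCusp_iff_isCusp_SL2Z] at hc ⊢
  exact hc

lemma slash_smul_complex {k : ℤ} {g : GL (Fin 2) ℚ}
    (hg : 0 < (g : Matrix (Fin 2) (Fin 2) ℚ).det) (r : ℂ) (f : ℍ → ℂ) :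
    (r • f) ∣[k] toR g = r • (f ∣[k] toR g) := by
  have : 0 < ((toR g : GL (Fin 2) ℝ) : Matrix (Fin 2) (Fin 2) ℝ).det := by
    rw [det_toR]; exact_mod_cast hg
  have hσ : UpperHalfPlane.σ (toR g) = ContinuousAlgEquiv.refl ℝ ℂ := if_pos this
  rw [ModularForm.smul_slash, hσ]
  rfl

/-- The Hecke operator `T_Δ` on `S_k(Γ)`. -/
def hecke {Γ : Subgroup SL(2, ℤ)} [Γ.FiniteIndex] {Δ : Set (GL (Fin 2) ℚ)}
    (hΔ : IsHeckeSet Γ Δ) (k : ℤ) : SCusp Γ k →ₗ[ℂ] SCusp Γ k where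
  toFun f :=
    { toFun := heckeFun hΔ k f
      slash_action_eq' := by
        rintro _ ⟨γ, hγ, rfl⟩
        exact heckeFun_slash hΔ f hγ
      holo' := .sum fun c _ => (CuspFormClass.holo f).slash k (toR c.out)
      zero_at_cusps' := by
        intro c hc g hg
        change IsZeroAtImInfty ((heckeFun hΔ k f) ∣[k] g)
        rw [heckeFun, SlashAction.sum_slash, IsZeroAtImInfty, Filter.ZeroAtFilter]
        rw [show (0 : ℂ) = ∑ c ∈ hΔ.finite.toFinset, 0 by simp, Finset.sum_fn]
        exact tendsto_finsetSum _ fun d _ => isZeroAt_slash f d.out hc g hg }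
  map_add' f g := by
    ext τ
    change heckeFun hΔ k (⇑f + ⇑g) τ = heckeFun hΔ k f τ + heckeFun hΔ k g τ
    simp [heckeFun, Finset.sum_add_distrib]
  map_smul' r f := by
    ext τ
    change heckeFun hΔ k (r • (f : ℍ → ℂ)) τ = (r • heckeFun hΔ k f) τ
    refine congrFun ?_ τ
    rw [heckeFun, heckeFun, Finset.smul_sum]
    refine Finset.sum_congr rfl fun c hc => ?_
    exact slash_smul_complex
      (hΔ.det_pos _ (out_mem hΔ ((Set.Finite.mem_toFinset _).mp hc))) r f

/-! ### The sets defining `T_α` and `T_n` -/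

lemma det_castQ (A : Matrix (Fin 2) (Fin 2) ℤ) :
    (A.map (Int.cast : ℤ → ℚ)).det = (A.det : ℚ) := by
  simp [Matrix.det_fin_two]

/-- An integral matrix of positive determinant as an element of `GL₂(ℚ)`. -/
def toQ (A : Matrix (Fin 2) (Fin 2) ℤ) (hA : 0 < A.det) : GL (Fin 2) ℚ :=
  Matrix.GeneralLinearGroup.mkOfDetNeZero (A.map (Int.cast : ℤ → ℚ)) (by
    rw [det_castQ]; exact_mod_cast hA.ne')

/-- The integral matrices of determinant `n`, inside `GL₂(ℚ)`. -/
def intDet (n : ℕ) : Set (GL (Fin 2) ℚ) :=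
  {g | ∃ A : Matrix (Fin 2) (Fin 2) ℤ, A.det = n ∧
    (g : Matrix (Fin 2) (Fin 2) ℚ) = A.map (Int.cast : ℤ → ℚ)}

lemma intDet_det {n : ℕ} {g : GL (Fin 2) ℚ} (hg : g ∈ intDet n) :
    (g : Matrix (Fin 2) (Fin 2) ℚ).det = n := by
  obtain ⟨A, hA, e⟩ := hg
  rw [e, det_castQ, hA]
  simp

lemma intDet_pos {n : ℕ} {g : GL (Fin 2) ℚ} (hg : g ∈ intDet n) :
    0 < (g : Matrix (Fin 2) (Fin 2) ℚ).det := by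
  have h := intDet_det hg
  have h0 : (g : Matrix (Fin 2) (Fin 2) ℚ).det ≠ 0 := g.det_ne_zero
  rw [h] at h0 ⊢
  exact lt_of_le_of_ne (by positivity) h0.symm

lemma fixedDet_orbit {m : ℤ} (hm : m ≠ 0) (A : FixedDetMatrix (Fin 2) ℤ m) :
    ∃ s : SL(2, ℤ), ∃ B ∈ FixedDetMatrices.reps m, A = s • B := by
  induction A using FixedDetMatrices.induction_on hm with
  | h0 A h1 h2 h3 h4 => exact ⟨1, A, ⟨h1, h2, h3, h4⟩, by simp⟩
  | hS B hB =>
    obtain ⟨s, C, hC, rfl⟩ := hB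
    exact ⟨_, C, hC, (mul_smul _ _ _).symm⟩
  | hT B hB =>
    obtain ⟨s, C, hC, rfl⟩ := hB
    exact ⟨_, C, hC, (mul_smul _ _ _).symm⟩

lemma finite_intDet (Γ : Subgroup SL(2, ℤ)) [Γ.FiniteIndex] (n : ℕ) :
    (rcoset Γ '' intDet n).Finite := by
  classical
  rcases Nat.eq_zero_or_pos n with rfl | hn
  · convert! Set.finite_empty
    rw [Set.image_eq_empty, Set.eq_empty_iff_forall_notMem]
    intro g hg
    have := intDet_pos hg
    rw [intDet_det hg] at this
    simp at this
  have hm : (n : ℤ) ≠ 0 := by exact_mod_cast hn.ne'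
  let F : (SL(2, ℤ) ⧸ Γ) × FixedDetMatrices.reps (n : ℤ) →
      Quotient (QuotientGroup.rightRel (Γ.map (mapGL ℚ))) := fun x =>
    rcoset Γ (mapGL ℚ (x.1.out)⁻¹ * toQ x.2.1.1 (by rw [x.2.1.2]; exact_mod_cast hn))
  refine (Set.finite_range F).subset ?_
  rintro _ ⟨g, ⟨A, hA, e⟩, rfl⟩
  obtain ⟨s, B, hB, hAB⟩ := fixedDet_orbit hm ⟨A, hA⟩
  have hAB' : A = s * B.1 := congrArg Subtype.val hAB
  refine ⟨(QuotientGroup.mk s⁻¹, ⟨B, hB⟩), ?_⟩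
  obtain ⟨γ, hγ⟩ := QuotientGroup.mk_out_eq_mul Γ s⁻¹
  have hg : g = mapGL ℚ s * toQ B.1 (by rw [B.2]; exact_mod_cast hn) := by
    apply Units.ext
    rw [e, hAB']
    ext i j
    simp [toQ, Matrix.mul_apply, Matrix.GeneralLinearGroup.mkOfDetNeZero]
  apply Quotient.sound
  rw [← Quotient.eq_iff_equiv, Quotient.eq, QuotientGroup.rightRel_apply, hg]
  refine ⟨γ, γ.2, ?_⟩
  simp only [hγ]
  simp [mul_assoc]

/-- `Δ_n`: the integral matrices of determinant `n` whose reduction mod `N` lies in `G`. -/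
def DeltaN {N : ℕ} (G : Subgroup (GL (Fin 2) (ZMod N))) (n : ℕ) : Set (GL (Fin 2) ℚ) :=
  {g | ∃ A : Matrix (Fin 2) (Fin 2) ℤ, A.det = n ∧ RedMem G A ∧
    (g : Matrix (Fin 2) (Fin 2) ℚ) = A.map (Int.cast : ℤ → ℚ)}

lemma isHeckeSet_DeltaN {N : ℕ} [NeZero N] (G : Subgroup (GL (Fin 2) (ZMod N))) (n : ℕ) :
    IsHeckeSet (Gam G) (DeltaN G n) where
  det_pos := fun g ⟨A, h1, _, h2⟩ => intDet_pos (n := n) ⟨A, h1, h2⟩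
  mul_left := by
    rintro γ hγ g ⟨A, h1, ⟨a, ha, haA⟩, h2⟩
    refine ⟨γ * A, by simp [h1], ⟨mapGL (ZMod N) γ * a, mul_mem hγ ha, ?_⟩, ?_⟩
    · rw [Units.val_mul, haA]
      ext i j
      simp [red, Matrix.mul_apply]
    · rw [Units.val_mul, h2]
      ext i j
      simp [Matrix.mul_apply]
  mul_right := by
    rintro γ hγ g ⟨A, h1, ⟨a, ha, haA⟩, h2⟩
    refine ⟨A * γ, by simp [h1], ⟨a * mapGL (ZMod N) γ, mul_mem ha hγ, ?_⟩, ?_⟩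
    · rw [Units.val_mul, haA]
      ext i j
      simp [red, Matrix.mul_apply]
    · rw [Units.val_mul, h2]
      ext i j
      simp [Matrix.mul_apply]
  finite := (finite_intDet (Gam G) n).subset
    (Set.image_mono fun _ ⟨A, h1, _, h2⟩ => ⟨A, h1, h2⟩)

/-- The double coset `Γ A Γ` in `GL₂(ℚ)`. -/
def dcoset (Γ : Subgroup SL(2, ℤ)) (A : Matrix (Fin 2) (Fin 2) ℤ) (hA : 0 < A.det) :
    Set (GL (Fin 2) ℚ) :=
  DoubleCoset.doubleCoset (toQ A hA) (Γ.map (mapGL ℚ)) (Γ.map (mapGL ℚ))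

lemma isHeckeSet_dcoset (Γ : Subgroup SL(2, ℤ)) [Γ.FiniteIndex] (A : Matrix (Fin 2) (Fin 2) ℤ)
    (hA : 0 < A.det) : IsHeckeSet Γ (dcoset Γ A hA) := by
  have hsub : dcoset Γ A hA ⊆ intDet A.det.toNat := by
    intro g hg
    obtain ⟨_, ⟨γ, _, rfl⟩, _, ⟨δ, _, rfl⟩, rfl⟩ := DoubleCoset.mem_doubleCoset.mp hg
    refine ⟨γ * A * δ, by simp [hA.le], ?_⟩
    rw [Units.val_mul, Units.val_mul]
    ext i j
    simp [toQ, Matrix.mul_apply, Matrix.GeneralLinearGroup.mkOfDetNeZero]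
  refine ⟨fun g hg => intDet_pos (hsub hg), ?_, ?_, (finite_intDet Γ _).subset (Set.image_mono hsub)⟩
  · intro γ hγ g hg
    obtain ⟨x, hx, y, hy, rfl⟩ := DoubleCoset.mem_doubleCoset.mp hg
    exact DoubleCoset.mem_doubleCoset.mpr
      ⟨mapGL ℚ γ * x, mul_mem (Subgroup.mem_map_of_mem _ hγ) hx, y, hy, by simp [mul_assoc]⟩
  · intro γ hγ g hg
    obtain ⟨x, hx, y, hy, rfl⟩ := DoubleCoset.mem_doubleCoset.mp hg
    exact DoubleCoset.mem_doubleCoset.mpr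
      ⟨x, hx, y * mapGL ℚ γ, mul_mem hy (Subgroup.mem_map_of_mem _ hγ), by simp [mul_assoc]⟩

/-- The double coset operator `T_α = T_{Γ_G α Γ_G}` on `S_k(Γ_G)`, for `α = A` integral of positive
determinant. -/
def heckeDC {N : ℕ} [NeZero N] (G : Subgroup (GL (Fin 2) (ZMod N))) (k : ℤ)
    (A : Matrix (Fin 2) (Fin 2) ℤ) (hA : 0 < A.det) : SCusp (Gam G) k →ₗ[ℂ] SCusp (Gam G) k :=
  hecke (isHeckeSet_dcoset (Gam G) A hA) k

/-- The Hecke operator `T_n = T_{Δ_n}` on `S_k(Γ_G)`. -/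
def heckeT {N : ℕ} [NeZero N] (G : Subgroup (GL (Fin 2) (ZMod N))) (k : ℤ) (n : ℕ) :
    SCusp (Gam G) k →ₗ[ℂ] SCusp (Gam G) k :=
  hecke (isHeckeSet_DeltaN G n) k

/-! ### Diamond operators -/

lemma Gam_le_nrm {N : ℕ} (G : Subgroup (GL (Fin 2) (ZMod N))) : Gam G ≤ Gam (nrm G) :=
  Subgroup.comap_mono Subgroup.le_normalizer

/-- `Γ_G` as a subgroup of `Γ_{𝔑(G)}`. -/
abbrev GamIn {N : ℕ} (G : Subgroup (GL (Fin 2) (ZMod N))) : Subgroup (Gam (nrm G)) :=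
  (Gam G).subgroupOf (Gam (nrm G))

/-- The map `f ↦ f|_γ` on `S_k(Γ_G)`, for `γ ∈ Γ_{𝔑(G)}`. -/
def diamondLin {N : ℕ} [NeZero N] (G : Subgroup (GL (Fin 2) (ZMod N))) (k : ℤ)
    (γ : Gam (nrm G)) : SCusp (Gam G) k →ₗ[ℂ] SCusp (Gam G) k where
  toFun f :=
    { toFun := (f : ℍ → ℂ) ∣[k] (γ : SL(2, ℤ))
      slash_action_eq' := by
        rintro _ ⟨δ, hδ, rfl⟩
        have hm : (γ : SL(2, ℤ)) * δ * (γ : SL(2, ℤ))⁻¹ ∈ Gam G := by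
          have h := Subgroup.mem_normalizer_iff.mp γ.2 (mapGL (ZMod N) δ)
          have h2 := h.mp hδ
          rw [← map_mul, ← map_inv, ← map_mul] at h2
          exact h2
        have h2 := SlashInvariantFormClass.slash_action_eq f _
          (Subgroup.mem_map_of_mem (mapGL ℝ) hm)
        change ((f : ℍ → ℂ) ∣[k] mapGL ℝ (γ : SL(2, ℤ))) ∣[k] mapGL ℝ δ
          = (f : ℍ → ℂ) ∣[k] mapGL ℝ (γ : SL(2, ℤ))
        rw [← SlashAction.slash_mul, ← map_mul]
        conv_rhs => rw [← h2]
        rw [← SlashAction.slash_mul, ← map_mul, inv_mul_cancel_right]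
      holo' := (CuspFormClass.holo f).slash k (mapGL ℝ (γ : SL(2, ℤ)))
      zero_at_cusps' := by
        intro c hc
        have := isZeroAt_slash f (mapGL ℚ (γ : SL(2, ℤ))) hc
        rw [toR_mapGL] at this
        exact this }
  map_add' f g := by
    ext τ
    change ((⇑f + ⇑g) ∣[k] (γ : SL(2, ℤ))) τ = _
    rw [SlashAction.add_slash]
    rfl
  map_smul' r f := by
    ext τ
    change ((r • ⇑f) ∣[k] (γ : SL(2, ℤ))) τ = _
    rw [ModularForm.SL_smul_slash]
    rfl

lemma diamondLin_mul_apply {N : ℕ} [NeZero N] (G : Subgroup (GL (Fin 2) (ZMod N))) (k : ℤ)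
    (γ δ : Gam (nrm G)) (f : SCusp (Gam G) k) :
    diamondLin G k (γ * δ) f = diamondLin G k δ (diamondLin G k γ f) := by
  ext τ
  change ((f : ℍ → ℂ) ∣[k] ((γ : SL(2, ℤ)) * (δ : SL(2, ℤ)))) τ
    = (((f : ℍ → ℂ) ∣[k] (γ : SL(2, ℤ))) ∣[k] (δ : SL(2, ℤ))) τ
  rw [SlashAction.slash_mul]

lemma diamondLin_of_mem {N : ℕ} [NeZero N] (G : Subgroup (GL (Fin 2) (ZMod N))) (k : ℤ)
    (γ : Gam (nrm G)) (h : γ ∈ GamIn G) (f : SCusp (Gam G) k) : diamondLin G k γ f = f := by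
  ext τ
  exact congrFun (SlashInvariantFormClass.slash_action_eq f _
    (Subgroup.mem_map_of_mem (mapGL ℝ) (Subgroup.mem_subgroupOf.mp h))) τ

/-- The diamond operator `⟨q⟩` on `S_k(Γ_G)`, for `q ∈ Γ_{𝔑(G)} / Γ_G`: it sends `f` to `f|_γ` for
any representative `γ` of `q`. It is invertible. -/
def diamond {N : ℕ} [NeZero N] (G : Subgroup (GL (Fin 2) (ZMod N))) (k : ℤ)
    (q : Gam (nrm G) ⧸ GamIn G) : SCusp (Gam G) k ≃ₗ[ℂ] SCusp (Gam G) k :=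
  Quotient.liftOn' q
    (fun γ => LinearEquiv.ofLinearMap (diamondLin G k γ) (diamondLin G k γ⁻¹)
      (by ext1 f
          rw [LinearMap.comp_apply, ← diamondLin_mul_apply, inv_mul_cancel,
            diamondLin_of_mem G k 1 (one_mem _)]; rfl)
      (by ext1 f
          rw [LinearMap.comp_apply, ← diamondLin_mul_apply, mul_inv_cancel,
            diamondLin_of_mem G k 1 (one_mem _)]; rfl))
    (by
      intro γ δ h
      rw [QuotientGroup.leftRel_apply] at h
      ext1 f
      change diamondLin G k γ f = diamondLin G k δ f
      conv_rhs => rw [show δ = γ * (γ⁻¹ * δ) by group, diamondLin_mul_apply,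
        diamondLin_of_mem G k _ h])

lemma diamond_mk {N : ℕ} [NeZero N] (G : Subgroup (GL (Fin 2) (ZMod N))) (k : ℤ)
    (γ : Gam (nrm G)) (f : SCusp (Gam G) k) :
    (diamond G k (QuotientGroup.mk γ) f : ℍ → ℂ) = (f : ℍ → ℂ) ∣[k] (γ : SL(2, ℤ)) := rfl

end

end HeckeAdj

open HeckeAdj

namespace HeckeAdj

noncomputable section

attribute [local instance] Subgroup.fintypeQuotientOfFiniteIndex

/-! ### The hyperbolic measure and the fundamental domain of `SL₂(ℤ)` -/

/-! The adjoint of `T_Δ` is `T_Δ'`, where `Δ'` consists of the adjugates of the elements of `Δ`. Let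
`w` be the weight `wt Γ`: it is nonnegative, and its translates under `Γ` sum to 2 almost
everywhere, so up to a constant `∫ w φ` is the integral of a `Γ`-invariant `φ` over `Γ\ℍ`. Unfolding
(`hasSum_unfold`) writes `2 ∫ w ⟨T_Δ f, g⟩` as the sum over all `α ∈ Δ`, not over cosets, of `∫
w(ατ) w(τ) ⟨f|α, g⟩(τ)`. The substitution `τ ↦ ατ` moves the slash from `f` to `g`, replaces `α` by
its adjugate and exchanges the two weights (`isAdjoint_hecke`). No fundamental domain for a
conjugate of `Γ` and no common system of left and right representatives is needed.

Diamond operators are the Hecke operators of the cosets `Γ_G σ`, and the adjugate on `SL₂` is the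
inverse; hence they are unitary.

Let `Δ` consist of integral matrices of determinant `n` with reduction in `G`, cut out by a
condition stable under `SL₂(ℤ)` on both sides and under adjugates. Take `a ∈ G` of determinant `n`
and `σ` reducing to `det(a) a⁻²`. If `A` reduces to `c`, then `adj(A) σ⁻¹` reduces to `c⁻¹ a² ∈ G`;
so the set of adjugates is `Δσ`, and likewise `σΔ`. Therefore `T* = ⟨σ⟩ T = T ⟨σ⟩`, and `T` commutes
with `T*`.

The operators `T_n` have this form at once. For `T_α`, strong approximation identifies `Γ_G α Γ_G`
with the matrices in `SL₂(ℤ) α SL₂(ℤ)` whose reduction lies in `G` (`dcoset_eq_redSet`), and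
diagonalization shows that `α` is equivalent to its adjugate (`slEquiv_adjugate`). For prime
determinant there is only one `SL₂(ℤ)`-class, whence `T_α = T_p`. -/

instance countable_SL2Z : Countable SL(2, ℤ) :=
  Function.Injective.countable
    (f := fun (γ : SL(2, ℤ)) (i j : Fin 2) => (γ : Matrix (Fin 2) (Fin 2) ℤ) i j)
    fun _ _ h => Matrix.SpecialLinearGroup.ext _ _ fun i j => congrFun (congrFun h i) j

instance smulInvariantMeasure_SL2Z : SMulInvariantMeasure SL(2, ℤ) ℍ volume where
  measure_preimage_smul γ _ hs := measure_preimage_smul_of_nullMeasurableSet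
    (G := GL (Fin 2) ℝ) hs.nullMeasurableSet (mapGL ℝ γ)

lemma measurable_smul_SL2Z (γ : SL(2, ℤ)) : Measurable fun τ : ℍ => γ • τ :=
  (continuous_const_smul (mapGL ℝ γ)).measurable

instance measurableConstSMul_SL2Z : MeasurableConstSMul SL(2, ℤ) ℍ where
  measurable_const_smul := measurable_smul_SL2Z

lemma volume_eq_zero_of_image {s : Set ℍ} (h : volume (UpperHalfPlane.coe '' s) = 0) :
    volume s = 0 := by
  rw [volume_eq_lintegral, setLIntegral_measure_zero _ _ h]

lemma volume_re_eq (c : ℝ) : volume {z : ℂ | z.re = c} = 0 := by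
  have : {z : ℂ | z.re = c} = Complex.measurableEquivRealProd ⁻¹' ({c} ×ˢ Set.univ) := by
    ext z; simp [Complex.measurableEquivRealProd]
  rw [this, Complex.volume_preserving_equiv_real_prod.measure_preimage_equiv]
  simp [Measure.volume_eq_prod]

/-- The boundary lies on the unit circle and two vertical lines, all Lebesgue null. -/
lemma volume_fd_diff_fdo : volume (𝒟 \ 𝒟ᵒ) = 0 := by
  apply volume_eq_zero_of_image
  refine measure_mono_null (t := Metric.sphere 0 1 ∪ ({z : ℂ | z.re = 1 / 2} ∪
    {z : ℂ | z.re = -(1 / 2)})) ?_ ?_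
  · rintro _ ⟨z, ⟨⟨h1, h2⟩, h3⟩, rfl⟩
    by_cases h4 : 1 < Complex.normSq z
    · right
      have h5 : ¬ |z.re| < 1 / 2 := fun h => h3 ⟨h4, h⟩
      have h6 : |z.re| = 1 / 2 := le_antisymm h2 (not_lt.mp h5)
      rcases eq_or_eq_neg_of_abs_eq h6 with h | h
      · left; simpa using h
      · right; simpa using h
    · left
      have h5 : Complex.normSq z = 1 := le_antisymm (not_lt.mp h4) h1
      rw [mem_sphere_zero_iff_norm]
      rw [Complex.normSq_eq_norm_sq] at h5
      nlinarith [norm_nonneg (z : ℂ)]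
  · simp only [measure_union_null_iff]
    exact ⟨Measure.addHaar_sphere _ _ _, volume_re_eq _, volume_re_eq _⟩

lemma measurableSet_fd : MeasurableSet (𝒟 : Set ℍ) := ModularGroup.isClosed_fd.measurableSet

lemma volume_fd_lt_top : volume (𝒟 : Set ℍ) < ⊤ := by
  rw [volume_eq_lintegral]
  -- A crude half-strip suffices: heights in `𝒟` are at least `√3/2 > 1/2`, and `y⁻²` is integrable
  -- above `1/2`.
  have hsub : UpperHalfPlane.coe '' 𝒟 ⊆ Complex.measurableEquivRealProd ⁻¹'
      (Set.Icc (-1) 1 ×ˢ Set.Ioi (1 / 2)) := by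
    rintro _ ⟨z, hz, rfl⟩
    have h1 := ModularGroup.three_le_four_mul_im_sq_of_mem_fd hz
    have h2 := abs_le.mp hz.2
    have h3 := z.im_pos
    refine ⟨⟨?_, ?_⟩, ?_⟩
    · change -1 ≤ z.re; linarith
    · change z.re ≤ 1; linarith
    · change 1 / 2 < z.im; nlinarith
  refine (lintegral_mono_set hsub).trans_lt ?_
  have e := Complex.volume_preserving_equiv_real_prod.setLIntegral_comp_preimage_emb
    Complex.measurableEquivRealProd.measurableEmbedding
    (fun p : ℝ × ℝ => ((((1 / ‖p.2‖₊) ^ 2 : NNReal)) : ENNReal)) (Set.Icc (-1) 1 ×ˢ Set.Ioi (1 / 2))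
  have e' : ∫⁻ z : ℂ in Complex.measurableEquivRealProd ⁻¹' (Set.Icc (-1) 1 ×ˢ Set.Ioi (1 / 2)),
      ((((1 / ‖z.im‖₊) ^ 2 : NNReal)) : ENNReal) = _ := e
  rw [e', Measure.volume_eq_prod, ← Measure.prod_restrict,
    lintegral_prod _ (by fun_prop)]
  simp only [lintegral_const, Measure.restrict_apply_univ]
  refine ENNReal.mul_lt_top ?_ (by simp)
  have hi := (integrableOn_Ioi_rpow_of_lt (a := -2) (c := 1 / 2) (by norm_num)
    (by norm_num)).2
  refine lt_of_le_of_lt (setLIntegral_mono' measurableSet_Ioi fun y hy => ?_) hi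
  have hy0 : (0 : ℝ) < y := lt_trans (by norm_num) hy
  rw [enorm_eq_nnnorm]
  norm_cast
  rw [← NNReal.coe_le_coe]
  simp [abs_of_pos hy0]

lemma volume_pos_of_isOpen {U : Set ℍ} (hU : IsOpen U) (hne : U.Nonempty) : 0 < volume U := by
  rw [pos_iff_ne_zero]
  intro h0
  rw [volume_eq_lintegral] at h0
  have hU' := isOpenEmbedding_coe.isOpenMap U hU
  rw [setLIntegral_eq_zero_iff hU'.measurableSet (by fun_prop)] at h0
  have h1 : volume (UpperHalfPlane.coe '' U) = 0 := by
    rw [measure_eq_zero_iff_ae_notMem]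
    filter_upwards [h0] with z hz
    intro hz'
    have h2 := hz hz'
    obtain ⟨τ, -, rfl⟩ := hz'
    simp [τ.im_ne_zero] at h2
  exact (hU'.measure_pos volume (hne.image _)).ne' h1

instance isOpenPosMeasure : Measure.IsOpenPosMeasure (volume : Measure ℍ) :=
  ⟨fun _ hU hne => (volume_pos_of_isOpen hU hne).ne'⟩

lemma volume_fd_pos : 0 < volume (𝒟 : Set ℍ) := by
  refine (volume_pos_of_isOpen ModularGroup.isOpen_fdo ?_).trans_le
    (measure_mono ModularGroup.fdo_subset_fd)
  by_contra h
  rw [Set.not_nonempty_iff_eq_empty] at h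
  have h1 := ModularGroup.fd_eq_closure_fdo
  rw [h, closure_empty] at h1
  exact (h1 ▸ ModularGroup.I_mem_fd : UpperHalfPlane.I ∈ (∅ : Set ℍ))

/-- The indicator function of `𝒟`. -/
def fdInd : ℍ → ℝ := (𝒟 : Set ℍ).indicator 1

lemma fdInd_nonneg (τ : ℍ) : 0 ≤ fdInd τ := Set.indicator_nonneg (fun _ _ => zero_le_one) τ

lemma measurable_fdInd : Measurable fdInd := measurable_one.indicator measurableSet_fd

/-- Almost every orbit avoids the boundary of `𝒟`, hence meets `𝒟` in a single point, reached by
exactly two elements `±δ`. -/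
lemma ae_hasSum_fdInd : ∀ᵐ τ : ℍ, HasSum (fun δ : SL(2, ℤ) => fdInd (δ • τ)) 2 := by
  have h1 : ∀ᵐ τ : ℍ, ∀ δ : SL(2, ℤ), δ • τ ∈ 𝒟 → δ • τ ∈ 𝒟ᵒ := by
    rw [ae_all_iff]
    intro δ
    have h2 : ∀ᵐ τ : ℍ, τ ∈ 𝒟 → τ ∈ 𝒟ᵒ := by
      rw [ae_iff]
      convert volume_fd_diff_fdo using 2
      ext τ; simp
    exact (measurePreserving_smul δ volume).quasiMeasurePreserving.ae h2
  filter_upwards [h1] with τ hτ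
  obtain ⟨δ, hδ⟩ := ModularGroup.exists_smul_mem_fd τ
  have hne : δ ≠ -δ := by
    intro h
    have h00 : ∀ i j, (δ : Matrix (Fin 2) (Fin 2) ℤ) i j = 0 := fun i j => by
      have := congrArg (fun g : SL(2, ℤ) => (g : Matrix (Fin 2) (Fin 2) ℤ) i j) h
      simp only [Matrix.SpecialLinearGroup.coe_neg, Matrix.neg_apply] at this
      omega
    have h01 := δ.det_coe
    rw [Matrix.det_fin_two, h00, h00, h00] at h01
    norm_num at h01
  have key := hasSum_sum_of_ne_finset_zero (f := fun δ' : SL(2, ℤ) => fdInd (δ' • τ))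
    (s := {δ, -δ}) (L := SummationFilter.unconditional _) ?_
  · rw [Finset.sum_pair hne] at key
    have e : fdInd (δ • τ) = 1 := Set.indicator_of_mem hδ _
    rw [ModularGroup.SL_neg_smul, e] at key
    convert key using 1
    norm_num
  · intro δ' hδ'
    refine Set.indicator_of_notMem (fun h => hδ' ?_) _
    have h3 : (δ' * δ⁻¹) • δ • τ ∈ 𝒟 := by
      rwa [← mul_smul, inv_mul_cancel_right]
    rcases ModularGroup.eq_one_or_neg_one_of_mem_fdo_mem_fd (hτ δ hδ) h3 with h4 | h4
    · rw [mul_inv_eq_one] at h4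
      simp [h4]
    · rw [mul_inv_eq_iff_eq_mul] at h4
      simp [h4]

/-! ### Weights on the upper half-plane replacing fundamental domains -/

/-- Every element of a group is uniquely a chosen coset representative times an element of the
subgroup. -/
lemma bijective_out_mul {α : Type*} [Group α] (H : Subgroup α) :
    Function.Bijective fun p : H × (α ⧸ H) => p.2.out * (p.1 : α) := by
  constructor
  · rintro ⟨h, q⟩ ⟨h', q'⟩ e
    have e1 : q = q' := by
      have := congrArg (QuotientGroup.mk : α → α ⧸ H) e
      simpa using this
    subst e1
    simpa using e
  · intro g
    obtain ⟨h, hh⟩ := QuotientGroup.mk_out_eq_mul H g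
    exact ⟨(h⁻¹, g), by simp [hh]⟩

/-- The number of translates of `𝒟` under representatives of `SL₂(ℤ) / Γ` that contain `τ`. -/
def wt (Γ : Subgroup SL(2, ℤ)) [Γ.FiniteIndex] (τ : ℍ) : ℝ :=
  ∑ q : SL(2, ℤ) ⧸ Γ, fdInd (q.out • τ)

lemma wt_nonneg (Γ : Subgroup SL(2, ℤ)) [Γ.FiniteIndex] (τ : ℍ) : 0 ≤ wt Γ τ := Finset.sum_nonneg fun _ _ => fdInd_nonneg _

lemma measurable_wt (Γ : Subgroup SL(2, ℤ)) [Γ.FiniteIndex] : Measurable (wt Γ) :=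
  Finset.measurable_fun_sum _ fun q _ => measurable_fdInd.comp (measurable_smul_SL2Z q.out)

/-- The sum over `SL₂(ℤ)` is regrouped along `q.out * γ`. The value 2 does not depend on whether `-1
∈ Γ`. -/
lemma ae_hasSum_wt (Γ : Subgroup SL(2, ℤ)) [Γ.FiniteIndex] : ∀ᵐ τ : ℍ, HasSum (fun γ : Γ => wt Γ ((γ : SL(2, ℤ)) • τ)) 2 := by
  filter_upwards [ae_hasSum_fdInd] with τ hτ
  rw [← (Equiv.ofBijective _ (bijective_out_mul Γ)).hasSum_iff] at hτ
  refine hτ.prod_fiberwise fun γ => ?_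
  have := hasSum_fintype fun q : SL(2, ℤ) ⧸ Γ => fdInd (q.out • (γ : SL(2, ℤ)) • τ)
  simpa [wt, mul_smul, -ModularGroup.sl_moeb] using! this

lemma integrable_fdInd_smul {φ : ℍ → ℂ} (hφ : Measurable φ) {C : ℝ} (hC : ∀ τ, ‖φ τ‖ ≤ C)
    (γ : SL(2, ℤ)) : Integrable fun τ => fdInd (γ • τ) • φ τ := by
  have h1 : Integrable fun τ => fdInd τ • φ (γ⁻¹ • τ) := by
    have : (fun τ => fdInd τ • φ (γ⁻¹ • τ)) = (𝒟 : Set ℍ).indicator fun τ => φ (γ⁻¹ • τ) := by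
      ext τ
      by_cases h : τ ∈ 𝒟 <;> simp [fdInd, h]
    rw [this, integrable_indicator_iff measurableSet_fd]
    exact Measure.integrableOn_of_bounded (M := C) volume_fd_lt_top.ne
      (hφ.comp (measurable_smul_SL2Z _)).aestronglyMeasurable
      (Filter.Eventually.of_forall fun τ => hC _)
  simpa only [Function.comp_def, inv_smul_smul] using
    (measurePreserving_smul γ (volume : Measure ℍ)).integrable_comp_of_integrable h1

lemma integral_fdInd_smul (φ : ℍ → ℂ) (γ : SL(2, ℤ)) :
    ∫ τ, fdInd (γ • τ) • φ τ = ∫ τ in 𝒟, φ (γ⁻¹ • τ) := by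
  rw [← integral_smul_eq_self (μ := volume) (fun τ : ℍ => fdInd (γ • τ) • φ τ) (g := γ⁻¹),
    ← integral_indicator measurableSet_fd]
  congr 1
  ext τ
  by_cases h : τ ∈ 𝒟 <;> simp [fdInd, h]

lemma integrable_wt_smul (Γ : Subgroup SL(2, ℤ)) [Γ.FiniteIndex] {φ : ℍ → ℂ} (hφ : Measurable φ) {C : ℝ} (hC : ∀ τ, ‖φ τ‖ ≤ C) :
    Integrable fun τ => wt Γ τ • φ τ := by
  simp only [wt, Finset.sum_smul]
  exact integrable_finsetSum _ fun q _ => integrable_fdInd_smul hφ hC _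

lemma integral_wt_smul (Γ : Subgroup SL(2, ℤ)) [Γ.FiniteIndex] {φ : ℍ → ℂ} (hφ : Measurable φ) {C : ℝ} (hC : ∀ τ, ‖φ τ‖ ≤ C) :
    ∫ τ, wt Γ τ • φ τ = ∑ q : SL(2, ℤ) ⧸ Γ, ∫ τ in 𝒟, φ ((q.out)⁻¹ • τ) := by
  simp only [wt, Finset.sum_smul]
  rw [integral_finsetSum _ fun q _ => integrable_fdInd_smul hφ hC _]
  exact Finset.sum_congr rfl fun q _ => integral_fdInd_smul _ _

/-- The index of `Γ` in `±Γ`. -/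
def signIndex (Γ : Subgroup SL(2, ℤ)) : ℕ := Nat.card
  ((Γ ⊔ Subgroup.zpowers (-1) : Subgroup SL(2, ℤ)) ⧸ Γ.subgroupOf (Γ ⊔ Subgroup.zpowers (-1)))

lemma signIndex_ne_zero (Γ : Subgroup SL(2, ℤ)) [Γ.FiniteIndex] : signIndex Γ ≠ 0 := by
  have : Finite ((Γ ⊔ Subgroup.zpowers (-1) : Subgroup SL(2, ℤ)) ⧸
    Γ.subgroupOf (Γ ⊔ Subgroup.zpowers (-1))) := inferInstance
  exact Nat.card_pos.ne'

lemma smul_eq_of_mem_sup (Γ : Subgroup SL(2, ℤ)) {φ : ℍ → ℂ} (hinv : ∀ γ ∈ Γ, ∀ τ : ℍ, φ (γ • τ) = φ τ) {δ : SL(2, ℤ)}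
    (hδ : δ ∈ Γ ⊔ Subgroup.zpowers (-1)) (τ : ℍ) : φ (δ • τ) = φ τ := by
  let K : Subgroup SL(2, ℤ) :=
    { carrier := {δ | ∀ τ : ℍ, φ (δ • τ) = φ τ}
      mul_mem' := fun {x y} hx hy τ => by rw [mul_smul, hx, hy]
      one_mem' := fun τ => by rw [one_smul]
      inv_mem' := fun {x} hx τ => by rw [← hx, smul_inv_smul] }
  have hK : Γ ⊔ Subgroup.zpowers (-1) ≤ K := by
    refine sup_le hinv ?_
    rw [Subgroup.zpowers_le]
    intro τ
    rw [ModularGroup.SL_neg_smul, one_smul]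
  exact hK hδ τ

lemma integralX_eq (Γ : Subgroup SL(2, ℤ)) [Γ.FiniteIndex] {φ : ℍ → ℂ} (hφ : Measurable φ) {C : ℝ} (hC : ∀ τ, ‖φ τ‖ ≤ C)
    (hinv : ∀ γ ∈ Γ, ∀ τ : ℍ, φ (γ • τ) = φ τ) :
    integralX Γ φ = (signIndex Γ : ℂ)⁻¹ * ∫ τ, wt Γ τ • φ τ := by
  have hle : Γ ≤ Γ ⊔ Subgroup.zpowers (-1) := le_sup_left
  have : (Γ ⊔ Subgroup.zpowers (-1)).FiniteIndex := Subgroup.finiteIndex_of_le hle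
  rw [eq_inv_mul_iff_mul_eq₀ (by exact_mod_cast signIndex_ne_zero Γ), integral_wt_smul Γ hφ hC,
    integralX, finsum_eq_sum_of_fintype,
    ← (Subgroup.quotientEquivProdOfLE hle).symm.sum_comp, Fintype.sum_prod_type, Finset.mul_sum]
  refine Finset.sum_congr rfl fun q _ => ?_
  -- Each class modulo `±Γ` splits into `signIndex Γ` classes modulo `Γ`, and these contribute equal
  -- integrals because `φ` is invariant under `±Γ`.
  trans ∑ _ : (Γ ⊔ Subgroup.zpowers (-1) : Subgroup SL(2, ℤ)) ⧸
    Γ.subgroupOf (Γ ⊔ Subgroup.zpowers (-1)), ∫ τ in 𝒟, φ ((q.out)⁻¹ • τ)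
  · simp [signIndex]
  · refine Finset.sum_congr rfl fun r _ => ?_
    induction r using QuotientGroup.induction_on with | _ r =>
    change _ = ∫ τ in 𝒟, φ ((QuotientGroup.mk (q.out * (r : SL(2, ℤ))) : SL(2, ℤ) ⧸ Γ).out⁻¹ • τ)
    obtain ⟨γ, hγ⟩ := QuotientGroup.mk_out_eq_mul Γ (q.out * (r : SL(2, ℤ)))
    rw [hγ]
    congr 1
    ext τ
    rw [mul_inv_rev, mul_inv_rev, mul_smul, mul_smul, hinv _ (inv_mem γ.2),
      smul_eq_of_mem_sup Γ hinv (inv_mem r.2)]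

/-! ### The Petersson integrand -/

lemma integrand_eq_petersson (k : ℤ) (f g : ℍ → ℂ) : integrand k f g = petersson k g f := by
  ext τ
  simp only [integrand, petersson]
  ring

lemma integrand_symm (k : ℤ) (f g : ℍ → ℂ) (τ : ℍ) :
    integrand k f g τ = conj (integrand k g f τ) := by
  rw [integrand_eq_petersson, integrand_eq_petersson, petersson_symm]

lemma integrand_smul_mem {Γ : Subgroup SL(2, ℤ)} {k : ℤ} (f g : SCusp Γ k) {γ : SL(2, ℤ)}
    (hγ : γ ∈ Γ) (τ : ℍ) : integrand k f g (γ • τ) = integrand k f g τ := by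
  rw [integrand_eq_petersson]
  exact SlashInvariantFormClass.petersson_smul (Γ := (Γ : Subgroup (GL (Fin 2) ℝ)))
    (Subgroup.mem_map_of_mem (mapGL ℝ) hγ)

lemma det_toR_pos {g : GL (Fin 2) ℚ} (hg : 0 < (g : Matrix (Fin 2) (Fin 2) ℚ).det) :
    0 < ((toR g : GL (Fin 2) ℝ) : Matrix (Fin 2) (Fin 2) ℝ).det := by
  rw [det_toR]
  exact_mod_cast hg

lemma sigma_toR {g : GL (Fin 2) ℚ} (hg : 0 < (g : Matrix (Fin 2) (Fin 2) ℚ).det) :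
    UpperHalfPlane.σ (toR g) = ContinuousAlgEquiv.refl ℝ ℂ := if_pos (det_toR_pos hg)

lemma continuous_slash {Γ : Subgroup SL(2, ℤ)} {k : ℤ} (f : SCusp Γ k) (g : GL (Fin 2) ℝ) :
    Continuous ((f : ℍ → ℂ) ∣[k] g) :=
  ((CuspFormClass.holo f).slash k g).continuous

lemma continuous_cusp {Γ : Subgroup SL(2, ℤ)} {k : ℤ} (f : SCusp Γ k) : Continuous f :=
  (CuspFormClass.holo f).continuous

lemma continuous_integrand {k : ℤ} {f g : ℍ → ℂ} (hf : Continuous f) (hg : Continuous g) :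
    Continuous (integrand k f g) := by
  rw [integrand_eq_petersson]
  exact petersson_continuous k hg hf

/-- The squared norm factors into the diagonal Petersson functions of `f|α` and of `g`; the first
is, up to the constant `D`, that of `f` at `ατ`. Both are bounded for cusp forms. -/
lemma exists_bound_integrand_slash {Γ : Subgroup SL(2, ℤ)} [Γ.FiniteIndex] {k : ℤ}
    (f g : SCusp Γ k) (α : GL (Fin 2) ℝ) :
    ∃ C : ℝ, ∀ τ, ‖integrand k ((f : ℍ → ℂ) ∣[k] α) g τ‖ ≤ C := by
  obtain ⟨A, hA⟩ := CuspFormClass.petersson_bounded_left k (Γ : Subgroup (GL (Fin 2) ℝ)) f f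
  obtain ⟨B, hB⟩ := CuspFormClass.petersson_bounded_left k (Γ : Subgroup (GL (Fin 2) ℝ)) g g
  set D : ℝ := ‖((|α.det.val| : ℝ) : ℂ) ^ (k - 2)‖
  have hA' : ∀ τ, ‖petersson k ((f : ℍ → ℂ) ∣[k] α) ((f : ℍ → ℂ) ∣[k] α) τ‖ ≤ D * A := by
    intro τ
    rw [petersson_slash, norm_mul, norm_σ]
    exact mul_le_mul_of_nonneg_left (hA _) (norm_nonneg _)
  -- From `x² ≤ M` follows `x ≤ 1 + M`, which avoids a square root.
  refine ⟨1 + D * A * B, fun τ => ?_⟩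
  have e : ‖integrand k ((f : ℍ → ℂ) ∣[k] α) g τ‖ ^ 2 =
      ‖petersson k ((f : ℍ → ℂ) ∣[k] α) ((f : ℍ → ℂ) ∣[k] α) τ‖ * ‖petersson k g g τ‖ := by
    simp only [integrand, petersson, norm_mul, Complex.norm_conj]
    ring
  have h1 := mul_le_mul (hA' τ) (hB τ) (norm_nonneg _) ((norm_nonneg _).trans (hA' τ))
  rw [← e] at h1
  nlinarith [norm_nonneg (integrand k ((f : ℍ → ℂ) ∣[k] α) g τ)]

lemma exists_bound_integrand {Γ : Subgroup SL(2, ℤ)} [Γ.FiniteIndex] {k : ℤ}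
    (f g : SCusp Γ k) : ∃ C : ℝ, ∀ τ, ‖integrand k f g τ‖ ≤ C := by
  simpa using exists_bound_integrand_slash f g 1

/-! ### Unfolding -/

lemma hasSum_prod_of_fintype {ι κ E : Type*} [Fintype κ] [AddCommMonoid E] [TopologicalSpace E]
    [ContinuousAdd E] {f : ι × κ → E} {a : κ → E} (h : ∀ x, HasSum (fun i => f (i, x)) (a x)) :
    HasSum f (∑ x, a x) := by
  classical
  have h1 : ∀ x, HasSum (fun p : ι × κ => if p.2 = x then f p else 0) (a x) := by
    intro x
    have hinj : Function.Injective fun i : ι => (i, x) := fun _ _ e => congrArg Prod.fst e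
    rw [← hinj.hasSum_iff]
    · simpa [Function.comp_def] using h x
    · rintro ⟨i, y⟩ hy
      refine if_neg fun (e : y = x) => hy ⟨i, by rw [e]⟩
  simpa using hasSum_sum (s := Finset.univ) fun x _ => h1 x

/-- Every element of a Hecke set is uniquely an element of `Γ` times a chosen representative of a
coset. -/
lemma bijective_mul_out {Γ : Subgroup SL(2, ℤ)} {Δ : Set (GL (Fin 2) ℚ)} (hΔ : IsHeckeSet Γ Δ) :
    Function.Bijective fun p : Γ × (rcoset Γ '' Δ) =>
      (⟨mapGL ℚ (p.1 : SL(2, ℤ)) * p.2.1.out, hΔ.mul_left _ p.1.2 _ (out_mem hΔ p.2.2)⟩ : Δ) := by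
  have hcl : ∀ (γ : Γ) (g : GL (Fin 2) ℚ), rcoset Γ (mapGL ℚ (γ : SL(2, ℤ)) * g) = rcoset Γ g := by
    intro γ g
    apply Quotient.sound
    rw [← Quotient.eq_iff_equiv, Quotient.eq, QuotientGroup.rightRel_apply]
    exact ⟨γ⁻¹, inv_mem γ.2, by simp⟩
  constructor
  · rintro ⟨γ, c⟩ ⟨γ', c'⟩ e
    have e0 : mapGL ℚ (γ : SL(2, ℤ)) * c.1.out = mapGL ℚ (γ' : SL(2, ℤ)) * c'.1.out :=
      congrArg Subtype.val e
    have e1 := congrArg (rcoset Γ) e0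
    rw [hcl, hcl, rcoset, rcoset, Quotient.out_eq, Quotient.out_eq] at e1
    have e2 : c = c' := Subtype.ext e1
    subst e2
    have e3 := mapGL_injective (mul_right_cancel e0)
    simp only [Prod.mk.injEq, and_true]
    exact Subtype.ext e3
  · rintro ⟨g, hg⟩
    have e := Quotient.mk_out (s := QuotientGroup.rightRel (Γ.map (mapGL ℚ))) g
    rw [QuotientGroup.rightRel_apply] at e
    obtain ⟨γ, hγ, hγ'⟩ := e
    refine ⟨(⟨γ, hγ⟩, ⟨rcoset Γ g, g, hg, rfl⟩), Subtype.ext ?_⟩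
    simp [hγ']

lemma integrand_sum {ι : Type*} (s : Finset ι) (k : ℤ) (F : ι → ℍ → ℂ) (g : ℍ → ℂ) (τ : ℍ) :
    integrand k (∑ i ∈ s, F i) g τ = ∑ i ∈ s, integrand k (F i) g τ := by
  simp [integrand, Finset.sum_mul]

lemma ae_smul_of_ae (g : GL (Fin 2) ℝ) {p : ℍ → Prop} (h : ∀ᵐ τ : ℍ, p τ) :
    ∀ᵐ τ : ℍ, p (g • τ) :=
  (measurePreserving_smul g (volume : Measure ℍ)).quasiMeasurePreserving.ae h

/-- Along a coset `Γα` the form `f|α` is constant and the weights `wt Γ (γατ)` sum to 2. `Φ` is left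
free so as to serve both for the integrand and for its norm, which dominates. -/
lemma ae_hasSum_wt_integrand {Γ : Subgroup SL(2, ℤ)} [Γ.FiniteIndex] {Δ : Set (GL (Fin 2) ℚ)}
    (hΔ : IsHeckeSet Γ Δ) {k : ℤ} (f : SCusp Γ k) {E : Type*} [NormedAddCommGroup E]
    [NormedSpace ℝ E] (Φ : (ℍ → ℂ) → ℍ → E) :
    ∀ᵐ τ : ℍ, HasSum (fun α : Δ => (wt Γ (toR α • τ) * wt Γ τ) • Φ ((f : ℍ → ℂ) ∣[k] toR α) τ)
      (wt Γ τ • (2 : ℝ) • ∑ c ∈ hΔ.finite.toFinset, Φ ((f : ℍ → ℂ) ∣[k] toR c.out) τ) := by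
  have : Finite (rcoset Γ '' Δ) := hΔ.finite
  have := Fintype.ofFinite (rcoset Γ '' Δ)
  let S : ℍ → Prop := fun τ => HasSum (fun γ : Γ => wt Γ ((γ : SL(2, ℤ)) • τ)) 2
  have h1 : ∀ᵐ τ : ℍ, ∀ c : rcoset Γ '' Δ, S (toR c.1.out • τ) := by
    refine ae_all_iff.mpr fun c => ?_
    exact ae_smul_of_ae (p := S) (toR c.1.out) (ae_hasSum_wt Γ)
  filter_upwards [h1] with τ hτ
  rw [← (Equiv.ofBijective _ (bijective_mul_out hΔ)).hasSum_iff]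
  have h3 : ∀ c : rcoset Γ '' Δ, HasSum (fun γ : Γ =>
      (wt Γ ((γ : SL(2, ℤ)) • toR c.1.out • τ) * wt Γ τ) •
        Φ ((f : ℍ → ℂ) ∣[k] toR c.1.out) τ)
      ((2 * wt Γ τ) • Φ ((f : ℍ → ℂ) ∣[k] toR c.1.out) τ) := by
    intro c
    have h4 : HasSum (fun γ : Γ => wt Γ ((γ : SL(2, ℤ)) • toR c.1.out • τ) * wt Γ τ)
      (2 * wt Γ τ) := (hτ c).mul_right _
    exact h4.smul_const _
  have h2 : HasSum (fun p : Γ × (rcoset Γ '' Δ) =>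
      (wt Γ ((p.1 : SL(2, ℤ)) • toR p.2.1.out • τ) * wt Γ τ) •
      Φ ((f : ℍ → ℂ) ∣[k] toR p.2.1.out) τ)
      (∑ c : rcoset Γ '' Δ, (2 * wt Γ τ) • Φ ((f : ℍ → ℂ) ∣[k] toR c.1.out) τ) :=
    hasSum_prod_of_fintype h3
  have e1 : ∀ p : Γ × (rcoset Γ '' Δ),
      (f : ℍ → ℂ) ∣[k] toR (mapGL ℚ (p.1 : SL(2, ℤ)) * p.2.1.out) =
        (f : ℍ → ℂ) ∣[k] toR p.2.1.out := by
    intro p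
    apply slash_eq_of_rcoset
    apply Quotient.sound
    rw [← Quotient.eq_iff_equiv, Quotient.eq, QuotientGroup.rightRel_apply]
    exact ⟨p.1⁻¹, inv_mem p.1.2, by simp⟩
  have e2 : ∀ p : Γ × (rcoset Γ '' Δ), toR (mapGL ℚ (p.1 : SL(2, ℤ)) * p.2.1.out) • τ =
      (p.1 : SL(2, ℤ)) • toR p.2.1.out • τ := by
    intro p
    rw [show toR (mapGL ℚ (p.1 : SL(2, ℤ)) * p.2.1.out) =
      toR (mapGL ℚ (p.1 : SL(2, ℤ))) * toR p.2.1.out from map_mul _ _ _, mul_smul, toR_mapGL]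
    rfl
  have e3 : wt Γ τ • (2 : ℝ) • ∑ c ∈ hΔ.finite.toFinset, Φ ((f : ℍ → ℂ) ∣[k] toR c.out) τ =
      ∑ c : rcoset Γ '' Δ, (2 * wt Γ τ) • Φ ((f : ℍ → ℂ) ∣[k] toR c.1.out) τ := by
    rw [← Finset.smul_sum, smul_smul, mul_comm]
    congr 1
    exact (Finset.sum_subtype _ (fun c => hΔ.finite.mem_toFinset)
      fun c => Φ ((f : ℍ → ℂ) ∣[k] toR c.out) τ)
  rw [e3]
  refine (iff_of_eq (congrArg (HasSum · _) (funext fun p => ?_))).mpr h2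
  change (wt Γ (toR (mapGL ℚ (p.1 : SL(2, ℤ)) * p.2.1.out) • τ) * wt Γ τ) •
    Φ ((f : ℍ → ℂ) ∣[k] toR (mapGL ℚ (p.1 : SL(2, ℤ)) * p.2.1.out)) τ = _
  rw [e1, e2]

lemma hasSum_unfold {Γ : Subgroup SL(2, ℤ)} [Γ.FiniteIndex] {Δ : Set (GL (Fin 2) ℚ)}
    (hΔ : IsHeckeSet Γ Δ) {k : ℤ} (f g : SCusp Γ k) :
    HasSum (fun α : Δ => ∫ τ, (wt Γ (toR α • τ) * wt Γ τ) •
        integrand k ((f : ℍ → ℂ) ∣[k] toR α) g τ)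
      (∫ τ, wt Γ τ • (2 : ℝ) • integrand k (heckeFun hΔ k f) g τ) := by
  have : Countable (GL (Fin 2) ℚ) := by
    refine Function.Injective.countable (f := fun (γ : GL (Fin 2) ℚ) (i j : Fin 2) => γ i j)
      fun _ _ h => Units.ext (Matrix.ext fun i j => congrFun (congrFun h i) j)
  refine hasSum_integral_of_dominated_convergence (fun α τ => (wt Γ (toR α • τ) * wt Γ τ) •
    ‖integrand k ((f : ℍ → ℂ) ∣[k] toR α) g τ‖) ?_ ?_ ?_ ?_ ?_
  · intro α
    refine (((measurable_wt Γ).comp (measurable_const_smul (toR α))).mul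
      (measurable_wt Γ)).aestronglyMeasurable.smul ?_
    exact (continuous_integrand (continuous_slash f _) (continuous_cusp g)).aestronglyMeasurable
  · intro α
    refine Filter.Eventually.of_forall fun τ => ?_
    rw [norm_smul, Real.norm_of_nonneg (mul_nonneg (wt_nonneg Γ _) (wt_nonneg Γ _)), smul_eq_mul]
  · filter_upwards [ae_hasSum_wt_integrand hΔ f fun F τ => ‖integrand k F g τ‖] with τ hτ
    exact hτ.summable
  · have h1 : Integrable fun τ : ℍ => wt Γ τ • (2 : ℝ) •
        ∑ c ∈ hΔ.finite.toFinset, ‖integrand k ((f : ℍ → ℂ) ∣[k] toR c.out) g τ‖ := by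
      simp only [Finset.smul_sum]
      refine integrable_finsetSum _ fun c _ => ?_
      obtain ⟨C, hC⟩ := exists_bound_integrand_slash f g (toR c.out)
      have h2 := (integrable_wt_smul Γ (continuous_integrand (k := k)
        (continuous_slash f (toR c.out)) (continuous_cusp g)).measurable hC).norm.const_mul 2
      refine h2.congr (Filter.Eventually.of_forall fun τ => ?_)
      simp only [norm_smul, Real.norm_of_nonneg (wt_nonneg Γ τ), smul_eq_mul]
      ring
    refine h1.congr ?_
    filter_upwards [ae_hasSum_wt_integrand hΔ f fun F τ => ‖integrand k F g τ‖] with τ hτ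
    exact hτ.tsum_eq.symm
  · filter_upwards [ae_hasSum_wt_integrand hΔ f fun F τ => integrand k F g τ] with τ hτ
    rwa [heckeFun, integrand_sum]

/-! ### Adjoints of Hecke operators -/

/-- The adjugate `det(g) g⁻¹` of an invertible matrix. -/
def adjGL {R : Type*} [CommRing R] (g : GL (Fin 2) R) : GL (Fin 2) R :=
  Matrix.GeneralLinearGroup.scalar (Fin 2) (Matrix.GeneralLinearGroup.det g) * g⁻¹

lemma adjGL_mul_self {R : Type*} [CommRing R] (g : GL (Fin 2) R) :
    adjGL g * g = Matrix.GeneralLinearGroup.scalar (Fin 2) (Matrix.GeneralLinearGroup.det g) := by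
  simp [adjGL]

lemma scalar_mul_comm {R : Type*} [CommRing R] (u : Rˣ) (g : GL (Fin 2) R) :
    Matrix.GeneralLinearGroup.scalar (Fin 2) u * g =
      g * Matrix.GeneralLinearGroup.scalar (Fin 2) u := by
  apply Units.ext
  ext i j
  simp [Matrix.GeneralLinearGroup.scalar, mul_comm]

lemma coe_adjGL {R : Type*} [CommRing R] (g : GL (Fin 2) R) :
    (adjGL g : Matrix (Fin 2) (Fin 2) R) = (g : Matrix (Fin 2) (Fin 2) R).adjugate := by
  have h := congrArg (fun x : GL (Fin 2) R => (x : Matrix (Fin 2) (Fin 2) R)) (adjGL_mul_self g)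
  have h1 : (g : Matrix (Fin 2) (Fin 2) R).adjugate * g =
      (Matrix.GeneralLinearGroup.scalar (Fin 2) (Matrix.GeneralLinearGroup.det g) :
        Matrix (Fin 2) (Fin 2) R) := by
    rw [Matrix.adjugate_mul]
    ext i j
    simp [Matrix.GeneralLinearGroup.scalar, Matrix.one_apply, Matrix.diagonal_apply]
  rw [← h1] at h
  exact (Units.mul_left_inj g).mp h

lemma adjGL_adjGL (g : GL (Fin 2) ℚ) : adjGL (adjGL g) = g := by
  apply Units.ext
  rw [coe_adjGL, coe_adjGL, Matrix.adjugate_adjugate' _ ]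
  simp

lemma adjGL_mapGL (γ : SL(2, ℤ)) : adjGL (mapGL ℚ γ) = mapGL ℚ γ⁻¹ := by
  have h : Matrix.GeneralLinearGroup.det (mapGL ℚ γ) = 1 := Units.ext (by simp)
  rw [adjGL, h, map_one, one_mul, map_inv]

lemma scalar_det_pos (u : ℚˣ) :
    0 < ((Matrix.GeneralLinearGroup.scalar (Fin 2) u : GL (Fin 2) ℚ) :
      Matrix (Fin 2) (Fin 2) ℚ).det := by
  have : (u : ℚ) ≠ 0 := u.ne_zero
  simp only [Matrix.GeneralLinearGroup.scalar, Units.coe_map,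
    Matrix.det_fin_two]
  simp

lemma toR_scalar_smul (u : ℚˣ) (τ : ℍ) :
    toR (Matrix.GeneralLinearGroup.scalar (Fin 2) u) • τ = τ := by
  have hu0 : ((u : ℚ) : ℂ) ≠ 0 := by exact_mod_cast u.ne_zero
  ext1
  rw [UpperHalfPlane.coe_smul_of_det_pos (det_toR_pos (scalar_det_pos u))]
  simp [num, denom, toR, Matrix.GeneralLinearGroup.scalar, hu0]

lemma slash_scalar (k : ℤ) (f : ℍ → ℂ) {u : ℚˣ} (hu : 0 < (u : ℚ)) :
    f ∣[k] toR (Matrix.GeneralLinearGroup.scalar (Fin 2) u) = ((u : ℚ) : ℂ) ^ (k - 2) • f := by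
  have hdet : ((Matrix.GeneralLinearGroup.scalar (Fin 2) u : GL (Fin 2) ℚ) :
      Matrix (Fin 2) (Fin 2) ℚ).det = u ^ 2 := by
    simp [Matrix.GeneralLinearGroup.scalar]
  have hu0 : ((u : ℚ) : ℂ) ≠ 0 := by exact_mod_cast hu.ne'
  ext τ
  rw [ModularForm.slash_def, sigma_toR (scalar_det_pos u)]
  beta_reduce
  rw [toR_scalar_smul, Matrix.GeneralLinearGroup.val_det_apply, det_toR, hdet]
  have hden : denom (toR (Matrix.GeneralLinearGroup.scalar (Fin 2) u)) τ = ((u : ℚ) : ℂ) := by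
    simp [denom, toR, Matrix.GeneralLinearGroup.scalar]
  rw [hden]
  simp only [ContinuousAlgEquiv.refl_apply, Pi.smul_apply, smul_eq_mul, Rat.cast_pow, abs_pow,
    abs_of_pos (show (0 : ℝ) < ((u : ℚ) : ℝ) by exact_mod_cast hu), Complex.ofReal_pow,
    Complex.ofReal_ratCast]
  -- The determinant gives `u^(2(k-1))` and the automorphy factor `u^(-k)`.
  rw [← zpow_natCast, ← zpow_mul, mul_assoc, ← zpow_add₀ hu0, mul_comm]
  congr 2
  push_cast
  ring

/-- Slashing `g|adj(α)` by `α` is slashing `g` by the scalar `det α`; the resulting factor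
`det(α)^(k-2)` is the one in `petersson_slash`, so the two cancel. -/
lemma integrand_slash_adjGL (k : ℤ) (f g : ℍ → ℂ) {α : GL (Fin 2) ℚ}
    (hα : 0 < (α : Matrix (Fin 2) (Fin 2) ℚ).det) (τ : ℍ) :
    integrand k f (g ∣[k] toR (adjGL α)) (toR α • τ) = integrand k (f ∣[k] toR α) g τ := by
  rw [integrand_eq_petersson, integrand_eq_petersson]
  have h1 := petersson_slash k (g ∣[k] toR (adjGL α)) f (toR α) τ
  have hd : (0 : ℝ) < ((α : Matrix (Fin 2) (Fin 2) ℚ).det : ℝ) := by exact_mod_cast hα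
  rw [← SlashAction.slash_mul, ← map_mul, adjGL_mul_self, slash_scalar k g
    (by simpa using hα), sigma_toR hα] at h1
  simp only [Matrix.GeneralLinearGroup.val_det_apply, det_toR, abs_of_pos hd] at h1
  have hd0 : (((α : Matrix (Fin 2) (Fin 2) ℚ).det : ℝ) : ℂ) ^ (k - 2) ≠ 0 :=
    zpow_ne_zero _ (by exact_mod_cast hα.ne')
  apply mul_left_cancel₀ hd0
  refine h1.symm.trans ?_
  simp only [petersson, Pi.smul_apply, smul_eq_mul, map_mul, map_zpow₀, map_ratCast, Complex.ofReal_ratCast]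
  ring

lemma peterssonInner_eq {Γ : Subgroup SL(2, ℤ)} [Γ.FiniteIndex] {k : ℤ} (f g : SCusp Γ k) :
    peterssonInner Γ k f g =
      (vol Γ)⁻¹ * ((signIndex Γ : ℂ)⁻¹ * ∫ τ, wt Γ τ • integrand k f g τ) := by
  obtain ⟨C, hC⟩ := exists_bound_integrand f g
  rw [peterssonInner, integralX_eq Γ (continuous_integrand (continuous_cusp f)
    (continuous_cusp g)).measurable hC fun γ hγ τ => integrand_smul_mem f g hγ τ]

lemma integral_wt_integrand_symm (k : ℤ) (f g : ℍ → ℂ)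
    (w : ℍ → ℝ) : ∫ τ, w τ • integrand k f g τ = conj (∫ τ, w τ • integrand k g f τ) := by
  rw [← integral_conj]
  congr 1
  ext τ
  rw [integrand_symm]
  simp

/-- Both sides unfold to sums over `Δ` and `Δ'`; the adjugate matches them term by term. -/
lemma isAdjoint_hecke {Γ : Subgroup SL(2, ℤ)} [Γ.FiniteIndex] {Δ Δ' : Set (GL (Fin 2) ℚ)}
    (hΔ : IsHeckeSet Γ Δ) (hΔ' : IsHeckeSet Γ Δ') (h : ∀ g, g ∈ Δ' ↔ adjGL g ∈ Δ) (k : ℤ) :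
    IsAdjoint Γ k (hecke hΔ k) (hecke hΔ' k) := by
  intro f g
  rw [peterssonInner_eq, peterssonInner_eq]
  congr 2
  have h1 := hasSum_unfold hΔ f g
  have h2 := (hasSum_unfold hΔ' g f).map (starRingEnd ℂ) Complex.continuous_conj
  let e : Δ ≃ Δ' :=
    { toFun := fun α => ⟨adjGL α, by rw [h, adjGL_adjGL]; exact α.2⟩
      invFun := fun β => ⟨adjGL β, (h _).mp β.2⟩
      left_inv := fun α => Subtype.ext (adjGL_adjGL _)
      right_inv := fun β => Subtype.ext (adjGL_adjGL _) }
  have he : ∀ α : Δ, (e α : GL (Fin 2) ℚ) = adjGL α := fun _ => rfl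
  rw [← e.hasSum_iff] at h2
  have h3 := ((iff_of_eq (congrArg (HasSum · _) (funext fun α => ?_))).mp h2).unique h1
  · have h4 : ∀ φ : ℍ → ℂ, ∫ τ, wt Γ τ • (2 : ℝ) • φ τ = (2 : ℝ) • ∫ τ, wt Γ τ • φ τ := by
      intro φ
      rw [← integral_smul]
      exact integral_congr_ae (Filter.Eventually.of_forall fun τ => smul_comm _ _ _)
    rw [eq_comm, h4, h4, Complex.real_smul, Complex.real_smul, map_mul, Complex.conj_ofReal] at h3
    have h5 := mul_left_cancel₀ (by norm_num) h3
    rw [← integral_wt_integrand_symm] at h5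
    exact h5
  -- Under `τ ↦ ατ` the weights at `adj(α)τ` and `τ` become those at `τ` and `ατ`, since `adj(α)α`
  -- is scalar and acts trivially.
  · simp only [Function.comp_apply]
    rw [he, ← integral_wt_integrand_symm k f _ fun τ => wt Γ (toR (adjGL α) • τ) * wt Γ τ]
    refine (integral_smul_eq_self (μ := volume) (fun τ : ℍ => (wt Γ (toR (adjGL α) • τ) *
      wt Γ τ) • integrand k f ((g : ℍ → ℂ) ∣[k] toR (adjGL α)) τ)
      (g := toR (α : GL (Fin 2) ℚ))).symm.trans ?_
    refine integral_congr_ae (Filter.Eventually.of_forall fun τ => ?_)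
    beta_reduce
    have h6 : toR (adjGL α : GL (Fin 2) ℚ) • toR (α : GL (Fin 2) ℚ) • τ = τ := by
      rw [← mul_smul, ← map_mul, adjGL_mul_self, toR_scalar_smul]
    rw [h6, integrand_slash_adjGL k f g (hΔ.det_pos _ α.2), mul_comm]

/-! ### Composition with diamond operators -/

lemma rcoset_eq_iff {Γ : Subgroup SL(2, ℤ)} {g h : GL (Fin 2) ℚ} :
    rcoset Γ g = rcoset Γ h ↔ h * g⁻¹ ∈ Γ.map (mapGL ℚ) := by
  rw [rcoset, rcoset, Quotient.eq, QuotientGroup.rightRel_apply]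

/-- Frees the operator from the representatives fixed by `Quotient.out`. -/
lemma heckeFun_eq_sum {Γ : Subgroup SL(2, ℤ)} {Δ : Set (GL (Fin 2) ℚ)} (hΔ : IsHeckeSet Γ Δ)
    {k : ℤ} (f : SCusp Γ k) {ι : Type*} (s : Finset ι) (r : ι → GL (Fin 2) ℚ)
    (hr : Set.BijOn (fun i => rcoset Γ (r i)) s (rcoset Γ '' Δ)) :
    heckeFun hΔ k f = ∑ i ∈ s, (f : ℍ → ℂ) ∣[k] toR (r i) := by
  symm
  refine Finset.sum_bij (fun i _ => rcoset Γ (r i)) ?_ ?_ ?_ ?_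
  · intro i hi
    exact hΔ.finite.mem_toFinset.mpr (hr.mapsTo hi)
  · intro i hi j hj e
    exact hr.injOn hi hj e
  · intro c hc
    obtain ⟨i, hi, e⟩ := hr.surjOn (hΔ.finite.mem_toFinset.mp hc)
    exact ⟨i, hi, e⟩
  · intro i _
    exact slash_eq_of_rcoset f (Quotient.out_eq _).symm

lemma conj_mem_map_Gam {N : ℕ} {G : Subgroup (GL (Fin 2) (ZMod N))} (σ : Gam (nrm G))
    {x : GL (Fin 2) ℚ} (hx : x ∈ (Gam G).map (mapGL ℚ)) :
    mapGL ℚ (σ : SL(2, ℤ)) * x * (mapGL ℚ (σ : SL(2, ℤ)))⁻¹ ∈ (Gam G).map (mapGL ℚ) := by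
  obtain ⟨δ, hδ, rfl⟩ := hx
  refine ⟨σ * δ * (σ : SL(2, ℤ))⁻¹, ?_, by simp⟩
  have h := (Subgroup.mem_normalizer_iff.mp σ.2 (mapGL (ZMod N) δ)).mp hδ
  rw [← map_mul, ← map_inv, ← map_mul] at h
  exact h

lemma conj_mem_map_Gam_iff {N : ℕ} {G : Subgroup (GL (Fin 2) (ZMod N))} (σ : Gam (nrm G))
    {x : GL (Fin 2) ℚ} :
    mapGL ℚ (σ : SL(2, ℤ)) * x * (mapGL ℚ (σ : SL(2, ℤ)))⁻¹ ∈ (Gam G).map (mapGL ℚ) ↔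
      x ∈ (Gam G).map (mapGL ℚ) := by
  refine ⟨fun h => ?_, conj_mem_map_Gam σ⟩
  have h1 := conj_mem_map_Gam σ⁻¹ h
  simpa [mul_assoc] using h1

section

variable {N : ℕ} [NeZero N] {G : Subgroup (GL (Fin 2) (ZMod N))} {Δ Δ' : Set (GL (Fin 2) ℚ)}

/-- Representatives `α` of `Γ\Δ` give representatives `ασ` of `Γ\Δσ`. -/
lemma diamond_comp_hecke (hΔ : IsHeckeSet (Gam G) Δ) (hΔ' : IsHeckeSet (Gam G) Δ') (k : ℤ)
    (σ : Gam (nrm G)) (h : ∀ g, g ∈ Δ' ↔ g * (mapGL ℚ (σ : SL(2, ℤ)))⁻¹ ∈ Δ) :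
    (diamond G k (QuotientGroup.mk σ)).toLinearMap ∘ₗ hecke hΔ k = hecke hΔ' k := by
  ext f τ
  change ((heckeFun hΔ k f) ∣[k] mapGL ℝ (σ : SL(2, ℤ))) τ = heckeFun hΔ' k f τ
  rw [heckeFun_eq_sum hΔ' f hΔ.finite.toFinset fun c => c.out * mapGL ℚ (σ : SL(2, ℤ)), heckeFun,
    SlashAction.sum_slash]
  · simp only [map_mul, SlashAction.slash_mul, toR_mapGL]
  refine ⟨fun c hc => ?_, fun c _ c' _ e => ?_, ?_⟩
  · refine ⟨_, (h _).mpr ?_, rfl⟩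
    rw [mul_inv_cancel_right]
    exact out_mem hΔ (hΔ.finite.mem_toFinset.mp hc)
  · simp only [rcoset_eq_iff, mul_inv_rev, mul_assoc, mul_inv_cancel_left] at e
    rw [← Quotient.out_eq c, ← Quotient.out_eq c']
    exact rcoset_eq_iff.mpr e
  · rintro _ ⟨g, hg, rfl⟩
    refine ⟨rcoset (Gam G) (g * (mapGL ℚ (σ : SL(2, ℤ)))⁻¹), ?_, ?_⟩
    · rw [Finset.mem_coe, hΔ.finite.mem_toFinset]
      exact ⟨_, (h g).mp hg, rfl⟩
    · simp only [rcoset_eq_iff, mul_inv_rev]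
      have := rcoset_eq_iff.mp (Quotient.out_eq (rcoset (Gam G) (g * (mapGL ℚ (σ : SL(2, ℤ)))⁻¹)))
      simpa only [mul_assoc] using this

/-- Here the representatives are `σα`; they stay inequivalent and exhaust `Γ\σΔ` because `σ`
normalizes `Γ_G`. -/
lemma hecke_comp_diamond (hΔ : IsHeckeSet (Gam G) Δ) (hΔ' : IsHeckeSet (Gam G) Δ') (k : ℤ)
    (σ : Gam (nrm G)) (h : ∀ g, g ∈ Δ' ↔ (mapGL ℚ (σ : SL(2, ℤ)))⁻¹ * g ∈ Δ) :
    hecke hΔ k ∘ₗ (diamond G k (QuotientGroup.mk σ)).toLinearMap = hecke hΔ' k := by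
  ext f τ
  change heckeFun hΔ k ((f : ℍ → ℂ) ∣[k] mapGL ℝ (σ : SL(2, ℤ))) τ = heckeFun hΔ' k f τ
  rw [heckeFun_eq_sum hΔ' f hΔ.finite.toFinset fun c => mapGL ℚ (σ : SL(2, ℤ)) * c.out, heckeFun]
  · simp only [map_mul, SlashAction.slash_mul, toR_mapGL]
  refine ⟨fun c hc => ?_, fun c _ c' _ e => ?_, ?_⟩
  · refine ⟨_, (h _).mpr ?_, rfl⟩
    rw [inv_mul_cancel_left]
    exact out_mem hΔ (hΔ.finite.mem_toFinset.mp hc)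
  · rw [rcoset_eq_iff, mul_inv_rev, ← mul_assoc, mul_assoc (mapGL ℚ (σ : SL(2, ℤ))),
      conj_mem_map_Gam_iff] at e
    rw [← Quotient.out_eq c, ← Quotient.out_eq c']
    exact rcoset_eq_iff.mpr e
  · rintro _ ⟨g, hg, rfl⟩
    refine ⟨rcoset (Gam G) ((mapGL ℚ (σ : SL(2, ℤ)))⁻¹ * g), ?_, ?_⟩
    · rw [Finset.mem_coe, hΔ.finite.mem_toFinset]
      exact ⟨_, (h g).mp hg, rfl⟩
    · have := rcoset_eq_iff.mp (Quotient.out_eq (rcoset (Gam G) ((mapGL ℚ (σ : SL(2, ℤ)))⁻¹ * g)))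
      rw [← conj_mem_map_Gam_iff σ] at this
      rw [rcoset_eq_iff]
      simpa only [mul_assoc, mul_inv_rev, mul_inv_cancel_left] using this

end

/-- The coset `Γ_G σ = σ Γ_G`. -/
def diamondSet {N : ℕ} (G : Subgroup (GL (Fin 2) (ZMod N))) (σ : Gam (nrm G)) :
    Set (GL (Fin 2) ℚ) :=
  {g | g * (mapGL ℚ (σ : SL(2, ℤ)))⁻¹ ∈ (Gam G).map (mapGL ℚ)}

lemma isHeckeSet_diamondSet {N : ℕ} (G : Subgroup (GL (Fin 2) (ZMod N))) (σ : Gam (nrm G)) :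
    IsHeckeSet (Gam G) (diamondSet G σ) where
  det_pos := by
    rintro g ⟨γ, -, hγ⟩
    have : g = mapGL ℚ (γ * (σ : SL(2, ℤ))) := by rw [map_mul, hγ, inv_mul_cancel_right]
    have h1 : (Matrix.GeneralLinearGroup.det (mapGL ℚ (γ * (σ : SL(2, ℤ)))) : ℚ) = 1 := by simp
    rw [this, ← Matrix.GeneralLinearGroup.val_det_apply, h1]
    exact zero_lt_one
  mul_left γ hγ g hg := by
    simpa only [diamondSet, Set.mem_ofPred_eq, mul_assoc] using
      mul_mem (Subgroup.mem_map_of_mem (mapGL ℚ) hγ) hg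
  mul_right γ hγ g hg := by
    have := mul_mem hg (conj_mem_map_Gam σ (Subgroup.mem_map_of_mem (mapGL ℚ) hγ))
    simpa only [diamondSet, Set.mem_ofPred_eq, mul_assoc, inv_mul_cancel_left] using this
  finite := by
    refine (Set.finite_singleton (rcoset (Gam G) (mapGL ℚ (σ : SL(2, ℤ))))).subset ?_
    rintro _ ⟨g, hg, rfl⟩
    exact (rcoset_eq_iff.mpr hg).symm

lemma hecke_diamondSet {N : ℕ} [NeZero N] (G : Subgroup (GL (Fin 2) (ZMod N))) (k : ℤ)
    (σ : Gam (nrm G)) : hecke (isHeckeSet_diamondSet G σ) k =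
      (diamond G k (QuotientGroup.mk σ)).toLinearMap := by
  ext f τ
  change heckeFun (isHeckeSet_diamondSet G σ) k f τ = ((f : ℍ → ℂ) ∣[k] mapGL ℝ (σ : SL(2, ℤ))) τ
  rw [heckeFun_eq_sum (isHeckeSet_diamondSet G σ) f {()} fun _ => mapGL ℚ (σ : SL(2, ℤ)), Finset.sum_singleton, toR_mapGL]
  refine ⟨fun _ _ => ⟨_, ?_, rfl⟩, fun _ _ _ _ _ => rfl, ?_⟩
  · simp only [diamondSet, Set.mem_ofPred_eq, mul_inv_cancel]
    exact one_mem _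
  · rintro _ ⟨g, hg, rfl⟩
    exact ⟨(), by simp, rcoset_eq_iff.mpr hg⟩

lemma adjGL_mem_diamondSet {N : ℕ} {G : Subgroup (GL (Fin 2) (ZMod N))} (σ : Gam (nrm G))
    {g : GL (Fin 2) ℚ} (hg : g ∈ diamondSet G σ) : adjGL g ∈ diamondSet G σ⁻¹ := by
  obtain ⟨γ, hγ, e⟩ := hg
  have e1 : g = mapGL ℚ (γ * (σ : SL(2, ℤ))) := by rw [map_mul, e, inv_mul_cancel_right]
  rw [e1, adjGL_mapGL, diamondSet]
  have h := conj_mem_map_Gam σ⁻¹ (Subgroup.mem_map_of_mem (mapGL ℚ) (inv_mem hγ))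
  simpa only [Set.mem_ofPred_eq, mul_inv_rev, map_mul, InvMemClass.coe_inv] using h

/-- Special case of `isAdjoint_hecke`: the adjugate carries `Γ_G σ` to `Γ_G σ⁻¹`. -/
lemma isAdjoint_diamond {N : ℕ} [NeZero N] (G : Subgroup (GL (Fin 2) (ZMod N))) (k : ℤ)
    (q : Gam (nrm G) ⧸ GamIn G) :
    IsAdjoint (Gam G) k (diamond G k q).toLinearMap (diamond G k q).symm.toLinearMap := by
  induction q using QuotientGroup.induction_on with | _ σ =>
  have e : (diamond G k (QuotientGroup.mk σ)).symm.toLinearMap =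
      (diamond G k (QuotientGroup.mk σ⁻¹)).toLinearMap := rfl
  rw [e, ← hecke_diamondSet, ← hecke_diamondSet]
  refine isAdjoint_hecke _ _ (fun g => ⟨fun h => ?_, fun h => ?_⟩) k
  · simpa using adjGL_mem_diamondSet σ⁻¹ h
  · simpa [adjGL_adjGL] using adjGL_mem_diamondSet σ h

/-! ### Lifting from `SL₂(ℤ/M)` to `SL₂(ℤ)` -/

lemma exists_isCoprime_add_mul {c d m : ℤ} (hc : c ≠ 0)
    (h : ∀ z : ℤ, Prime z → z ∣ c → z ∣ d → ¬ z ∣ m) : ∃ t : ℤ, IsCoprime c (d + t * m) := by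
  classical
  -- With `t` the product of the primes dividing `c` but not `d`, each prime divisor of `c` divides
  -- exactly one of `d` and `t * m`.
  refine ⟨∏ p ∈ c.natAbs.primeFactors.filter (fun p : ℕ => ¬ (p : ℤ) ∣ d), (p : ℤ), ?_⟩
  refine isCoprime_of_prime_dvd (fun h0 => hc h0.1) fun z hz hzc hzd => ?_
  have hzp : z.natAbs.Prime := Int.prime_iff_natAbs_prime.mp hz
  have hzd' : ∀ x : ℤ, ((z.natAbs : ℕ) : ℤ) ∣ x ↔ z ∣ x := fun x => Int.natAbs_dvd
  by_cases h1 : z ∣ d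
  · rw [dvd_add_right h1] at hzd
    rcases hz.dvd_or_dvd hzd with h2 | h2
    · obtain ⟨q, hq, hzq⟩ := hz.exists_mem_finset_dvd h2
      rw [Finset.mem_filter, Nat.mem_primeFactors] at hq
      have h3 : z.natAbs = q := (Nat.prime_dvd_prime_iff_eq hzp hq.1.1).mp
        (Int.natCast_dvd_natCast.mp ((hzd' _).mpr hzq))
      exact hq.2 (h3 ▸ (hzd' _).mpr h1)
    · exact h z hz hzc h1 h2
  · refine h1 ((dvd_add_left (Dvd.dvd.mul_right ?_ m)).mp hzd)
    rw [← hzd']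
    refine Finset.dvd_prod_of_mem (fun p : ℕ => (p : ℤ)) ?_
    rw [Finset.mem_filter, Nat.mem_primeFactors, hzd']
    exact ⟨⟨hzp, Int.natAbs_dvd_natAbs.mpr hzc, Int.natAbs_ne_zero.mpr hc⟩, h1⟩

lemma red_mul {N : ℕ} (A B : Matrix (Fin 2) (Fin 2) ℤ) : red N (A * B) = red N A * red N B := by
  ext i j
  simp [red, Matrix.mul_apply]

lemma red_det {N : ℕ} (A : Matrix (Fin 2) (Fin 2) ℤ) : (red N A).det = (A.det : ZMod N) := by
  simp [red, Matrix.det_fin_two]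

lemma red_adjugate {N : ℕ} (A : Matrix (Fin 2) (Fin 2) ℤ) :
    red N A.adjugate = (red N A).adjugate := by
  ext i j
  fin_cases i <;> fin_cases j <;> simp [red, Matrix.adjugate_fin_two]

lemma coe_mapGL_eq_red {N : ℕ} (γ : SL(2, ℤ)) :
    (mapGL (ZMod N) γ : Matrix (Fin 2) (Fin 2) (ZMod N)) = red N γ := by
  ext i j
  simp [red]

/-- Reduction `SL₂(ℤ) → SL₂(ℤ/M)` is surjective. -/
lemma exists_red_eq (M : ℕ) [NeZero M] (X : Matrix (Fin 2) (Fin 2) (ZMod M)) (hX : X.det = 1) :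
    ∃ γ : SL(2, ℤ), red M γ = X := by
  obtain ⟨a, ha⟩ := ZMod.intCast_surjective (X 0 0)
  obtain ⟨b, hb⟩ := ZMod.intCast_surjective (X 0 1)
  obtain ⟨c, hc0, hc⟩ : ∃ c : ℤ, c ≠ 0 ∧ (c : ZMod M) = X 1 0 := by
    obtain ⟨c, hc⟩ := ZMod.intCast_surjective (X 1 0)
    by_cases h : c = 0
    -- `exists_isCoprime_add_mul` needs a nonzero `c`.
    · refine ⟨M, by exact_mod_cast NeZero.ne M, ?_⟩
      rw [← hc, h]
      simp
    · exact ⟨c, h, hc⟩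
  obtain ⟨d, hd⟩ := ZMod.intCast_surjective (X 1 1)
  rw [Matrix.det_fin_two, ← ha, ← hb, ← hc, ← hd] at hX
  have hM : (M : ℤ) ∣ a * d - b * c - 1 := by
    rw [← ZMod.intCast_zmod_eq_zero_iff_dvd]
    push_cast
    rw [hX, sub_self]
  obtain ⟨t, ht⟩ := exists_isCoprime_add_mul (c := c) (d := d) (m := M) hc0 fun z hz h1 h2 h3 => by
    refine hz.not_isUnit (isUnit_of_dvd_one ?_)
    have h4 := dvd_sub ((h2.mul_left a).sub (h1.mul_left b)) (h3.trans hM)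
    simpa using h4
  obtain ⟨u, v, huv⟩ := ht
  set x := a * u + b * v
  -- The row `(v, -u)` completes the bottom row to determinant 1. Adding `x = a * u + b * v` times
  -- the bottom row keeps the determinant and makes the top row reduce to `(a, b)`.
  refine ⟨⟨!![v + x * c, -u + x * (d + t * M); c, d + t * M], ?_⟩, ?_⟩
  · rw [Matrix.det_fin_two_of]
    linear_combination huv
  · have huv' := congrArg (Int.cast : ℤ → ZMod M) huv
    push_cast at huv'
    rw [CharP.cast_eq_zero (ZMod M) M] at huv'
    ext i j
    fin_cases i <;> fin_cases j
    · simp [red, x, ← ha]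
      linear_combination (a : ZMod M) * huv' - (v : ZMod M) * hX
    · simp [red, x, ← hb]
      linear_combination (b : ZMod M) * huv' + (u : ZMod M) * hX
    · simp [red, ← hc]
    · simp [red, ← hd]

/-- A simultaneous approximation: `w ≡ w₀` mod `N` and `w ≡ 1` mod `n`. -/
lemma exists_red_eq_and_red_eq_one {N n : ℕ} [NeZero N] [NeZero n] (h : Nat.Coprime N n)
    (w₀ : SL(2, ℤ)) : ∃ w : SL(2, ℤ), red N w = red N w₀ ∧
      ∃ X : Matrix (Fin 2) (Fin 2) ℤ, (w : Matrix (Fin 2) (Fin 2) ℤ) = 1 + (n : ℤ) • X := by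
  obtain ⟨u, v, huv⟩ := Nat.isCoprime_iff_coprime.mpr h
  -- Chinese remaindering with `u * N + v * n = 1`. `B` has the required residues but determinant 1
  -- only modulo `N * n`; it is then replaced by a lift of its reduction to `SL₂(ℤ)`.
  set B : Matrix (Fin 2) (Fin 2) ℤ := (v * n) • (w₀ : Matrix (Fin 2) (Fin 2) ℤ) + (u * N) • 1
  have hdet : B.det - 1 = (N * n : ℕ) * (u * v * ((w₀ : Matrix (Fin 2) (Fin 2) ℤ).trace - 2)) := by
    have h1 := w₀.det_coe
    rw [Matrix.det_fin_two] at h1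
    simp only [B, Matrix.det_fin_two, Matrix.trace_fin_two, Matrix.add_apply, Matrix.smul_apply,
      smul_eq_mul, Matrix.one_apply_eq, Matrix.one_apply_ne (zero_ne_one (α := Fin 2)),
      Matrix.one_apply_ne (one_ne_zero (α := Fin 2))]
    push_cast
    linear_combination (v * n) ^ 2 * h1 + (u * N + v * n + 1) * huv
  have : NeZero (N * n) := ⟨mul_ne_zero (NeZero.ne N) (NeZero.ne n)⟩
  obtain ⟨w, hw⟩ := exists_red_eq (N * n) (red (N * n) B) (by
    rw [red_det, ← sub_eq_zero, ← Int.cast_one, ← Int.cast_sub, hdet]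
    rw [Int.cast_mul, Int.cast_natCast, CharP.cast_eq_zero, zero_mul])
  have hw' : ∀ i j, ((N * n : ℕ) : ℤ) ∣ (w : Matrix (Fin 2) (Fin 2) ℤ) i j - B i j := by
    intro i j
    rw [← ZMod.intCast_zmod_eq_zero_iff_dvd, Int.cast_sub, sub_eq_zero]
    exact congrFun (congrFun hw i) j
  choose Y hY using hw'
  refine ⟨w, ?_, fun i j => N * Y i j + v * ((w₀ : Matrix (Fin 2) (Fin 2) ℤ) i j -
    (1 : Matrix (Fin 2) (Fin 2) ℤ) i j), ?_⟩
  · ext i j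
    simp only [red, Matrix.map_apply]
    rw [← sub_eq_zero, ← Int.cast_sub, ZMod.intCast_zmod_eq_zero_iff_dvd]
    refine ⟨n * Y i j + u * ((1 : Matrix (Fin 2) (Fin 2) ℤ) i j -
      (w₀ : Matrix (Fin 2) (Fin 2) ℤ) i j), ?_⟩
    have h1 := hY i j
    simp only [B, Matrix.add_apply, Matrix.smul_apply, smul_eq_mul] at h1
    push_cast at h1
    linear_combination h1 + (w₀ : Matrix (Fin 2) (Fin 2) ℤ) i j * huv
  · ext i j
    have h1 := hY i j
    simp only [B, Matrix.add_apply, Matrix.smul_apply, smul_eq_mul] at h1 ⊢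
    push_cast at h1
    change _ = _ + (n : ℤ) * (N * Y i j + v * ((w₀ : Matrix (Fin 2) (Fin 2) ℤ) i j -
      (1 : Matrix (Fin 2) (Fin 2) ℤ) i j))
    linear_combination h1 + (1 : Matrix (Fin 2) (Fin 2) ℤ) i j * huv

/-! ### Equivalence of integral matrices -/

/-- `B ∈ SL₂(ℤ) A SL₂(ℤ)`. -/
def SLEquiv (A B : Matrix (Fin 2) (Fin 2) ℤ) : Prop :=
  ∃ s t : SL(2, ℤ), B = s * A * t

lemma SLEquiv.refl (A : Matrix (Fin 2) (Fin 2) ℤ) : SLEquiv A A := ⟨1, 1, by simp⟩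

lemma SLEquiv.symm {A B : Matrix (Fin 2) (Fin 2) ℤ} (h : SLEquiv A B) : SLEquiv B A := by
  obtain ⟨s, t, rfl⟩ := h
  refine ⟨s⁻¹, t⁻¹, ?_⟩
  have h1 : (s⁻¹ : SL(2, ℤ)).1 * s.1 = 1 := congrArg Subtype.val (inv_mul_cancel s)
  have h2 : t.1 * (t⁻¹ : SL(2, ℤ)).1 = 1 := congrArg Subtype.val (mul_inv_cancel t)
  rw [← mul_assoc, ← mul_assoc, h1, mul_assoc, h2, one_mul, mul_one]

lemma SLEquiv.trans {A B C : Matrix (Fin 2) (Fin 2) ℤ} (h : SLEquiv A B) (h' : SLEquiv B C) :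
    SLEquiv A C := by
  obtain ⟨s, t, rfl⟩ := h
  obtain ⟨s', t', rfl⟩ := h'
  exact ⟨s' * s, t * t', by simp [mul_assoc]⟩

lemma SLEquiv.det_eq {A B : Matrix (Fin 2) (Fin 2) ℤ} (h : SLEquiv A B) : B.det = A.det := by
  obtain ⟨s, t, rfl⟩ := h
  simp

lemma slEquiv_mul_left (s : SL(2, ℤ)) (A : Matrix (Fin 2) (Fin 2) ℤ) : SLEquiv A (s * A) :=
  ⟨s, 1, by simp⟩

lemma slEquiv_mul_right (t : SL(2, ℤ)) (A : Matrix (Fin 2) (Fin 2) ℤ) : SLEquiv A (A * t) :=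
  ⟨1, t, by simp⟩

/-- Euclid's algorithm on the upper left entry: if it fails to divide a neighbour, a nonzero
remainder of smaller absolute value takes its place. No divisibility `x ∣ y` is needed later. -/
lemma exists_slEquiv_diagonal_of_ne_zero (A : Matrix (Fin 2) (Fin 2) ℤ) (hA : A 0 0 ≠ 0) :
    ∃ x y : ℤ, SLEquiv A !![x, 0; 0, y] := by
  induction hm : (A 0 0).natAbs using Nat.strong_induction_on generalizing A with | _ m ih =>
  by_cases h1 : A 0 0 ∣ A 1 0
  · by_cases h2 : A 0 0 ∣ A 0 1
    · obtain ⟨q, hq⟩ := h1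
      obtain ⟨r, hr⟩ := h2
      refine ⟨A 0 0, A 1 1 - q * A 0 1, ⟨!![1, 0; -q, 1], by simp [Matrix.det_fin_two_of]⟩,
        ⟨!![1, -r; 0, 1], by simp [Matrix.det_fin_two_of]⟩, ?_⟩
      rw [Matrix.eta_fin_two A]
      simp only [Matrix.mul_fin_two, hq, hr]
      ext i j
      fin_cases i <;> fin_cases j <;> simp <;> ring
    · let t : SL(2, ℤ) := ⟨!![-(A 0 1 / A 0 0), -1; 1, 0], by simp [Matrix.det_fin_two_of]⟩
      have e : (A * (t : Matrix (Fin 2) (Fin 2) ℤ)) 0 0 = A 0 1 % A 0 0 := by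
        rw [Matrix.mul_apply, Fin.sum_univ_two, Int.emod_def]
        simp [t]; ring
      have hlt : ((A * (t : Matrix (Fin 2) (Fin 2) ℤ)) 0 0).natAbs < m := by
        rw [e, ← hm]
        have := Int.emod_nonneg (A 0 1) hA
        have := Int.abs_eq_natAbs (A 0 0) ▸ Int.emod_lt_abs (A 0 1) hA
        omega
      obtain ⟨x, y, hxy⟩ := ih _ hlt (A * (t : Matrix (Fin 2) (Fin 2) ℤ))
        (by rw [e]; exact fun h => h2 (Int.dvd_of_emod_eq_zero h)) rfl
      exact ⟨x, y, (slEquiv_mul_right t A).trans hxy⟩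
  · let s : SL(2, ℤ) := ⟨!![-(A 1 0 / A 0 0), 1; -1, 0], by simp [Matrix.det_fin_two_of]⟩
    have e : ((s : Matrix (Fin 2) (Fin 2) ℤ) * A) 0 0 = A 1 0 % A 0 0 := by
      rw [Matrix.mul_apply, Fin.sum_univ_two, Int.emod_def]
      simp [s]; ring
    have hlt : (((s : Matrix (Fin 2) (Fin 2) ℤ) * A) 0 0).natAbs < m := by
      rw [e, ← hm]
      have := Int.emod_nonneg (A 1 0) hA
      have := Int.abs_eq_natAbs (A 0 0) ▸ Int.emod_lt_abs (A 1 0) hA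
      omega
    obtain ⟨x, y, hxy⟩ := ih _ hlt ((s : Matrix (Fin 2) (Fin 2) ℤ) * A)
      (by rw [e]; exact fun h => h1 (Int.dvd_of_emod_eq_zero h)) rfl
    exact ⟨x, y, (slEquiv_mul_left s A).trans hxy⟩

lemma exists_slEquiv_diagonal (A : Matrix (Fin 2) (Fin 2) ℤ) (hA : A.det ≠ 0) :
    ∃ x y : ℤ, SLEquiv A !![x, 0; 0, y] := by
  by_cases h : A 0 0 = 0
  · let s : SL(2, ℤ) := ⟨!![0, 1; -1, 0], by simp [Matrix.det_fin_two_of]⟩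
    have e : ((s : Matrix (Fin 2) (Fin 2) ℤ) * A) 0 0 = A 1 0 := by
      rw [Matrix.mul_apply, Fin.sum_univ_two]
      simp [s]
    obtain ⟨x, y, hxy⟩ := exists_slEquiv_diagonal_of_ne_zero
      ((s : Matrix (Fin 2) (Fin 2) ℤ) * A) (by
        rw [e]
        intro h1
        rw [Matrix.det_fin_two, h, h1] at hA
        simp at hA)
    exact ⟨x, y, (slEquiv_mul_left s A).trans hxy⟩
  · exact exists_slEquiv_diagonal_of_ne_zero A h

lemma slEquiv_diagonal_swap (x y : ℤ) : SLEquiv !![x, 0; 0, y] !![y, 0; 0, x] :=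
  ⟨⟨!![0, -1; 1, 0], by simp [Matrix.det_fin_two_of]⟩,
    ⟨!![0, 1; -1, 0], by simp [Matrix.det_fin_two_of]⟩, by simp⟩

lemma SLEquiv.adjugate {A B : Matrix (Fin 2) (Fin 2) ℤ} (h : SLEquiv A B) :
    SLEquiv A.adjugate B.adjugate := by
  obtain ⟨s, t, rfl⟩ := h
  exact ⟨t⁻¹, s⁻¹, by simp [Matrix.adjugate_mul_distrib, mul_assoc]⟩

/-- For a diagonal matrix the adjugate swaps the two entries, which a Weyl element also does. -/
lemma slEquiv_adjugate (A : Matrix (Fin 2) (Fin 2) ℤ) (hA : A.det ≠ 0) :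
    SLEquiv A A.adjugate := by
  obtain ⟨x, y, h⟩ := exists_slEquiv_diagonal A hA
  refine (h.trans (slEquiv_diagonal_swap x y)).trans ?_
  have := h.adjugate.symm
  simpa [Matrix.adjugate_fin_two] using this

/-- Integral matrices of the same prime determinant are equivalent. -/
lemma slEquiv_of_det_prime {p : ℕ} (hp : p.Prime) {A B : Matrix (Fin 2) (Fin 2) ℤ}
    (hA : A.det = p) (hB : B.det = p) : SLEquiv A B := by
  have key : ∀ C : Matrix (Fin 2) (Fin 2) ℤ, C.det = p → SLEquiv C !![1, 0; 0, (p : ℤ)] := by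
    intro C hC
    have hp0 : (p : ℤ) ≠ 0 := by exact_mod_cast hp.ne_zero
    obtain ⟨x, y, h⟩ := exists_slEquiv_diagonal C (by rwa [hC])
    refine h.trans ?_
    have hneg : SLEquiv !![x, 0; 0, y] !![-x, 0; 0, -y] :=
      ⟨-1, 1, by simp⟩
    have hxy : x * y = p := by
      have := h.det_eq
      rwa [hC, Matrix.det_fin_two_of, mul_zero, sub_zero] at this
    have hpr : Prime (p : ℤ) := Nat.prime_iff_prime_int.mp hp
    rcases (Irreducible.isUnit_or_isUnit hpr.irreducible hxy.symm) with hu | hu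
    · rcases Int.isUnit_iff.mp hu with rfl | rfl
      · rw [← hxy, one_mul]
        exact SLEquiv.refl _
      · rw [← hxy]
        simpa using hneg
    · refine SLEquiv.trans ?_ (slEquiv_diagonal_swap _ _)
      rcases Int.isUnit_iff.mp hu with rfl | rfl
      · rw [← hxy, mul_one]
        exact SLEquiv.refl _
      · rw [← hxy]
        simpa using hneg
  exact (key A hA).trans (key B hB).symm

lemma RedMem.isCoprime_det {N : ℕ} {G : Subgroup (GL (Fin 2) (ZMod N))}
    {A : Matrix (Fin 2) (Fin 2) ℤ} (hA : RedMem G A) : IsCoprime A.det (N : ℤ) := by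
  obtain ⟨a, -, ha⟩ := hA
  rw [isCoprime_comm, ← ZMod.coe_int_isUnit_iff_isCoprime, ← red_det, ← ha]
  exact (Matrix.isUnit_iff_isUnit_det _).mp a.isUnit

/-- Equivalent matrices with reductions in `G` lie in the same double coset of `Γ_G`. -/
lemma exists_mem_Gam_of_slEquiv {N : ℕ} [NeZero N] {G : Subgroup (GL (Fin 2) (ZMod N))}
    {A B : Matrix (Fin 2) (Fin 2) ℤ} (hA : 0 < A.det) (hAG : RedMem G A) (hBG : RedMem G B)
    (h : SLEquiv A B) : ∃ s ∈ Gam G, ∃ t ∈ Gam G, B = (s : SL(2, ℤ)) * A * (t : SL(2, ℤ)) := by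
  obtain ⟨s, t, hst⟩ := h
  obtain ⟨n, hn⟩ := Int.eq_ofNat_of_zero_le hA.le
  have hn0 : n ≠ 0 := by rintro rfl; simp [hn] at hA
  have : NeZero n := ⟨hn0⟩
  have hcop : Nat.Coprime N n := by
    have := hAG.isCoprime_det
    rw [hn] at this
    exact (Nat.isCoprime_iff_coprime.mp this).symm
  obtain ⟨w, hw, X, hX⟩ := exists_red_eq_and_red_eq_one hcop s
  -- This is `A⁻¹ w A`, integral because `w ≡ 1` modulo `n = det A`. Hence `s A t = (s w⁻¹) A (t₁
  -- t)`, where `s w⁻¹` is trivial modulo `N`.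
  set t₁ : Matrix (Fin 2) (Fin 2) ℤ := 1 + A.adjugate * X * A
  have ht₁ : A * t₁ = w * A := by
    have h1 : A * A.adjugate = (n : ℤ) • 1 := by rw [Matrix.mul_adjugate, hn]
    rw [hX, mul_add, add_mul, ← mul_assoc, ← mul_assoc, h1]
    simp
  have hdet₁ : t₁.det = 1 := by
    have h1 := congrArg Matrix.det ht₁
    rw [Matrix.det_mul, Matrix.det_mul, det_coe, one_mul] at h1
    exact mul_left_cancel₀ hA.ne' (h1.trans (mul_one _).symm)
  let t₂ : SL(2, ℤ) := ⟨t₁, hdet₁⟩ * t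
  have hB : B = (s * w⁻¹ : SL(2, ℤ)) * A * t₂ := by
    have h1 : (w⁻¹ : SL(2, ℤ)).1 * w.1 = 1 := congrArg Subtype.val (inv_mul_cancel w)
    have h2 : (w⁻¹ : SL(2, ℤ)).1 * (A * t₁) = A := by rw [ht₁, ← mul_assoc, h1, one_mul]
    have h3 : ∀ S W T : Matrix (Fin 2) (Fin 2) ℤ, W * (A * t₁) = A →
        S * A * T = S * W * A * (t₁ * T) := by
      intro S W T h
      conv_lhs => rw [← h]
      simp only [mul_assoc]
    rw [hst]
    exact h3 _ _ _ h2
  have hs : mapGL (ZMod N) (s * w⁻¹) = 1 := by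
    have h1 : mapGL (ZMod N) s = mapGL (ZMod N) w := by
      apply Units.ext
      rw [coe_mapGL_eq_red, coe_mapGL_eq_red, hw]
    rw [map_mul, map_inv, h1, mul_inv_cancel]
  refine ⟨s * w⁻¹, ?_, t₂, ?_, hB⟩
  · rw [Gam, Subgroup.mem_comap, hs]
    exact one_mem G
  · obtain ⟨a, ha, haA⟩ := hAG
    obtain ⟨b, hb, hbB⟩ := hBG
    rw [Gam, Subgroup.mem_comap]
    have e : b = mapGL (ZMod N) (s * w⁻¹) * a * mapGL (ZMod N) t₂ := by
      apply Units.ext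
      rw [Units.val_mul, Units.val_mul, coe_mapGL_eq_red, coe_mapGL_eq_red, haA, hbB, ← red_mul,
        ← red_mul, ← hB]
    rw [hs, one_mul] at e
    have : mapGL (ZMod N) t₂ = a⁻¹ * b := by rw [e, inv_mul_cancel_left]
    rw [this]
    exact mul_mem (inv_mem ha) hb

/-! ### Hecke sets cut out by congruence conditions -/

/-- The integral matrices satisfying `Q` whose reduction lies in `G`. -/
def redSet {N : ℕ} (G : Subgroup (GL (Fin 2) (ZMod N))) (Q : Matrix (Fin 2) (Fin 2) ℤ → Prop) :
    Set (GL (Fin 2) ℚ) :=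
  {g | ∃ A : Matrix (Fin 2) (Fin 2) ℤ, Q A ∧ RedMem G A ∧
    (g : Matrix (Fin 2) (Fin 2) ℚ) = A.map (Int.cast : ℤ → ℚ)}

lemma coe_mapGL_rat (γ : SL(2, ℤ)) : (mapGL ℚ γ : Matrix (Fin 2) (Fin 2) ℚ) =
    (γ : Matrix (Fin 2) (Fin 2) ℤ).map (Int.cast : ℤ → ℚ) := by
  ext i j
  simp

lemma map_intCast_mul (A B : Matrix (Fin 2) (Fin 2) ℤ) :
    (A * B).map (Int.cast : ℤ → ℚ) = A.map (Int.cast : ℤ → ℚ) * B.map (Int.cast : ℤ → ℚ) := by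
  ext i j
  simp [Matrix.mul_apply]

lemma map_intCast_adjugate (A : Matrix (Fin 2) (Fin 2) ℤ) :
    A.adjugate.map (Int.cast : ℤ → ℚ) = (A.map (Int.cast : ℤ → ℚ)).adjugate := by
  ext i j
  fin_cases i <;> fin_cases j <;> simp [Matrix.adjugate_fin_two]

/-- Puts `T_α` in the same shape as `T_n`, so that one argument covers both. -/
lemma dcoset_eq_redSet {N : ℕ} [NeZero N] {G : Subgroup (GL (Fin 2) (ZMod N))}
    {A : Matrix (Fin 2) (Fin 2) ℤ} (hA : 0 < A.det) (hAG : RedMem G A) :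
    dcoset (Gam G) A hA = redSet G (SLEquiv A) := by
  ext g
  constructor
  · intro hg
    obtain ⟨_, ⟨γ, hγ, rfl⟩, _, ⟨δ, hδ, rfl⟩, rfl⟩ := DoubleCoset.mem_doubleCoset.mp hg
    obtain ⟨a, ha, haA⟩ := hAG
    refine ⟨γ * A * δ, ⟨γ, δ, rfl⟩, ⟨mapGL (ZMod N) γ * a * mapGL (ZMod N) δ,
      mul_mem (mul_mem hγ ha) hδ, ?_⟩, ?_⟩
    · rw [Units.val_mul, Units.val_mul, coe_mapGL_eq_red, coe_mapGL_eq_red, haA, red_mul, red_mul]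
    · rw [Units.val_mul, Units.val_mul, coe_mapGL_rat, coe_mapGL_rat, map_intCast_mul,
        map_intCast_mul]
      rfl
  · rintro ⟨B, hAB, hBG, hg⟩
    obtain ⟨s, hs, t, ht, rfl⟩ := exists_mem_Gam_of_slEquiv hA hAG hBG hAB
    refine DoubleCoset.mem_doubleCoset.mpr ⟨mapGL ℚ s, Subgroup.mem_map_of_mem _ hs, mapGL ℚ t,
      Subgroup.mem_map_of_mem _ ht, Units.ext ?_⟩
    rw [hg, Units.val_mul, Units.val_mul, coe_mapGL_rat, coe_mapGL_rat, map_intCast_mul,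
        map_intCast_mul]
    rfl

lemma isHeckeSet_mul_right {N : ℕ} {G : Subgroup (GL (Fin 2) (ZMod N))} {Δ : Set (GL (Fin 2) ℚ)}
    (hΔ : IsHeckeSet (Gam G) Δ) (σ : Gam (nrm G)) :
    IsHeckeSet (Gam G) {g | g * (mapGL ℚ (σ : SL(2, ℤ)))⁻¹ ∈ Δ} where
  det_pos g hg := by
    have h := hΔ.det_pos _ hg
    have h1 : (Matrix.GeneralLinearGroup.det (mapGL ℚ (σ : SL(2, ℤ)))⁻¹ : ℚ) = 1 := by simp
    rwa [Units.val_mul, Matrix.det_mul, ← Matrix.GeneralLinearGroup.val_det_apply (_ : GL _ _)⁻¹,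
      h1, mul_one] at h
  mul_left γ hγ g hg := by
    simpa only [Set.mem_ofPred_eq, mul_assoc] using hΔ.mul_left γ hγ _ hg
  mul_right γ hγ g hg := by
    obtain ⟨δ, hδ, e⟩ := conj_mem_map_Gam σ (Subgroup.mem_map_of_mem (mapGL ℚ) hγ)
    have h := hΔ.mul_right δ hδ _ hg
    rw [e] at h
    simpa only [Set.mem_ofPred_eq, mul_assoc, inv_mul_cancel_left] using h
  finite := by
    refine (hΔ.finite.image fun c => rcoset (Gam G) (c.out * mapGL ℚ (σ : SL(2, ℤ)))).subset ?_
    rintro _ ⟨g, hg, rfl⟩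
    refine ⟨_, ⟨_, hg, rfl⟩, ?_⟩
    have := rcoset_eq_iff.mp (Quotient.out_eq (rcoset (Gam G) (g * (mapGL ℚ (σ : SL(2, ℤ)))⁻¹)))
    rw [rcoset_eq_iff, mul_inv_rev]
    simpa only [mul_assoc] using this

/-- If the reductions of `A` and of `σ` are `c` and `det(a) a⁻²` with `det c = det a`, then the
reductions of `adj(A) σ⁻¹` and `σ⁻¹ adj(A)` are `c⁻¹ a²` and `a² c⁻¹`. -/
lemma redMem_adjugate_mul {N : ℕ} {G : Subgroup (GL (Fin 2) (ZMod N))} {a : GL (Fin 2) (ZMod N)}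
    (ha : a ∈ G) {σ : SL(2, ℤ)} (hσ : mapGL (ZMod N) σ = adjGL a * a⁻¹)
    {A : Matrix (Fin 2) (Fin 2) ℤ} (hA : RedMem G A)
    (hdet : (A.det : ZMod N) = (a : Matrix (Fin 2) (Fin 2) (ZMod N)).det) :
    RedMem G (A.adjugate * (σ⁻¹ : SL(2, ℤ))) ∧ RedMem G ((σ⁻¹ : SL(2, ℤ)) * A.adjugate) := by
  obtain ⟨c, hc, hcA⟩ := hA
  have hd : Matrix.GeneralLinearGroup.det c = Matrix.GeneralLinearGroup.det a := by
    apply Units.ext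
    rw [Matrix.GeneralLinearGroup.val_det_apply, Matrix.GeneralLinearGroup.val_det_apply, hcA,
      red_det, hdet]
  have hadj : (adjGL c : Matrix (Fin 2) (Fin 2) (ZMod N)) = red N A.adjugate := by
    rw [coe_adjGL, hcA, red_adjugate]
  have hσ' : mapGL (ZMod N) σ⁻¹ = a * (adjGL a)⁻¹ := by rw [map_inv, hσ, mul_inv_rev, inv_inv]
  set u := Matrix.GeneralLinearGroup.scalar (Fin 2) (Matrix.GeneralLinearGroup.det a) with hu
  have hcomm : ∀ x, u * x = x * u := fun x => scalar_mul_comm _ x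
  have e1 : adjGL c * mapGL (ZMod N) σ⁻¹ = c⁻¹ * a * a := by
    rw [hσ', adjGL, adjGL, hd, ← hu, hcomm c⁻¹, mul_inv_rev, inv_inv]
    rw [show c⁻¹ * u * (a * (a * u⁻¹)) = c⁻¹ * (u * (a * a)) * u⁻¹ by group, hcomm]
    group
  have e2 : mapGL (ZMod N) σ⁻¹ * adjGL c = a * a * c⁻¹ := by
    rw [hσ', adjGL, adjGL, hd, ← hu]
    group
  constructor
  · refine ⟨c⁻¹ * a * a, mul_mem (mul_mem (inv_mem hc) ha) ha, ?_⟩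
    rw [← e1, Units.val_mul, coe_mapGL_eq_red, hadj, red_mul]
  · refine ⟨a * a * c⁻¹, mul_mem (mul_mem ha ha) (inv_mem hc), ?_⟩
    rw [← e2, Units.val_mul, coe_mapGL_eq_red, hadj, red_mul]

/-- The class of matrices defining a Hecke operator of degree `n`: stable under multiplication by
`SL₂(ℤ)` and under passage to the adjugate. -/
structure IsHeckeClass (n : ℕ) (Q : Matrix (Fin 2) (Fin 2) ℤ → Prop) : Prop where
  det_eq : ∀ A, Q A → A.det = n
  mul_left : ∀ A, Q A → ∀ s : SL(2, ℤ), Q (s * A)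
  mul_right : ∀ A, Q A → ∀ s : SL(2, ℤ), Q (A * s)
  adjugate : ∀ A, Q A → Q A.adjugate

lemma isHeckeClass_det (n : ℕ) : IsHeckeClass n fun A => A.det = n where
  det_eq A hA := hA
  mul_left A hA s := by simpa using hA
  mul_right A hA s := by simpa using hA
  adjugate A hA := by simpa [Matrix.det_adjugate] using hA

lemma isHeckeClass_slEquiv (A : Matrix (Fin 2) (Fin 2) ℤ) (hA : 0 < A.det) :
    IsHeckeClass A.det.toNat (SLEquiv A) where
  det_eq B h := by rw [h.det_eq, Int.toNat_of_nonneg hA.le]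
  mul_left B h s := h.trans (slEquiv_mul_left s B)
  mul_right B h s := h.trans (slEquiv_mul_right s B)
  adjugate B h := (slEquiv_adjugate A hA.ne').trans h.adjugate

section

variable {N n : ℕ} {G : Subgroup (GL (Fin 2) (ZMod N))} {Q : Matrix (Fin 2) (Fin 2) ℤ → Prop}
  {a : GL (Fin 2) (ZMod N)} {σ : SL(2, ℤ)}

lemma mul_mem_redSet_of_adjGL (hQ : IsHeckeClass n Q) (ha : a ∈ G)
    (hdet : (a : Matrix (Fin 2) (Fin 2) (ZMod N)).det = n)
    (hσ : mapGL (ZMod N) σ = adjGL a * a⁻¹) {g : GL (Fin 2) ℚ} (hg : adjGL g ∈ redSet G Q) :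
    g * (mapGL ℚ σ)⁻¹ ∈ redSet G Q ∧ (mapGL ℚ σ)⁻¹ * g ∈ redSet G Q := by
  obtain ⟨A, hAQ, hAG, e⟩ := hg
  have e' : (g : Matrix (Fin 2) (Fin 2) ℚ) = A.adjugate.map (Int.cast : ℤ → ℚ) := by
    rw [map_intCast_adjugate, ← e, ← coe_adjGL, adjGL_adjGL]
  obtain ⟨h1, h2⟩ := redMem_adjugate_mul ha hσ hAG
    (by rw [hQ.det_eq A hAQ, hdet, Int.cast_natCast])
  rw [← map_inv]
  refine ⟨⟨_, hQ.mul_right _ (hQ.adjugate A hAQ) _, h1, ?_⟩,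
    ⟨_, hQ.mul_left _ (hQ.adjugate A hAQ) _, h2, ?_⟩⟩
  · rw [Units.val_mul, e', coe_mapGL_rat, map_intCast_mul]
  · rw [Units.val_mul, e', coe_mapGL_rat, map_intCast_mul]

lemma adjGL_mul {R : Type*} [CommRing R] (g h : GL (Fin 2) R) :
    adjGL (g * h) = adjGL h * adjGL g := by
  apply Units.ext
  rw [Units.val_mul, coe_adjGL, coe_adjGL, coe_adjGL, Units.val_mul, Matrix.adjugate_mul_distrib]

lemma adjGL_mem_redSet (hQ : IsHeckeClass n Q) (ha : a ∈ G)
    (hdet : (a : Matrix (Fin 2) (Fin 2) (ZMod N)).det = n)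
    (hσ : mapGL (ZMod N) σ = adjGL a * a⁻¹) {g : GL (Fin 2) ℚ} (hg : g ∈ redSet G Q) :
    adjGL (g * mapGL ℚ σ) ∈ redSet G Q ∧ adjGL (mapGL ℚ σ * g) ∈ redSet G Q := by
  have h := mul_mem_redSet_of_adjGL hQ ha hdet hσ (g := adjGL g) (by rwa [adjGL_adjGL])
  rw [adjGL_mul, adjGL_mul, adjGL_mapGL, map_inv]
  exact h.symm

/-- In terms of sets, `Δσ = adj(Δ)`; the left-handed version below gives `σΔ = adj(Δ)`. -/
lemma mem_iff_mul_right (hQ : IsHeckeClass n Q) (ha : a ∈ G)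
    (hdet : (a : Matrix (Fin 2) (Fin 2) (ZMod N)).det = n)
    (hσ : mapGL (ZMod N) σ = adjGL a * a⁻¹) (g : GL (Fin 2) ℚ) :
    g * (mapGL ℚ σ)⁻¹ ∈ redSet G Q ↔ adjGL g ∈ redSet G Q :=
  ⟨fun h => by simpa using (adjGL_mem_redSet hQ ha hdet hσ h).1,
    fun h => (mul_mem_redSet_of_adjGL hQ ha hdet hσ h).1⟩

lemma mem_iff_mul_left (hQ : IsHeckeClass n Q) (ha : a ∈ G)
    (hdet : (a : Matrix (Fin 2) (Fin 2) (ZMod N)).det = n)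
    (hσ : mapGL (ZMod N) σ = adjGL a * a⁻¹) (g : GL (Fin 2) ℚ) :
    (mapGL ℚ σ)⁻¹ * g ∈ redSet G Q ↔ adjGL g ∈ redSet G Q :=
  ⟨fun h => by simpa using (adjGL_mem_redSet hQ ha hdet hσ h).2,
    fun h => (mul_mem_redSet_of_adjGL hQ ha hdet hσ h).2⟩

end

section

variable {N n : ℕ} [NeZero N] {G : Subgroup (GL (Fin 2) (ZMod N))}
  {Q : Matrix (Fin 2) (Fin 2) ℤ → Prop} {a : GL (Fin 2) (ZMod N)} {σ : Gam (nrm G)}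

lemma isAdjoint_hecke_redSet (hΔ : IsHeckeSet (Gam G) (redSet G Q)) (hQ : IsHeckeClass n Q)
    (ha : a ∈ G) (hdet : (a : Matrix (Fin 2) (Fin 2) (ZMod N)).det = n)
    (hσ : mapGL (ZMod N) (σ : SL(2, ℤ)) = adjGL a * a⁻¹) (k : ℤ) :
    IsAdjoint (Gam G) k (hecke hΔ k)
      ((diamond G k (QuotientGroup.mk σ)).toLinearMap ∘ₗ hecke hΔ k) := by
  rw [diamond_comp_hecke hΔ (isHeckeSet_mul_right hΔ σ) k σ fun g => Iff.rfl]
  exact isAdjoint_hecke _ _ (fun g => mem_iff_mul_right hQ ha hdet hσ g) k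

lemma diamond_comp_hecke_comm (hΔ : IsHeckeSet (Gam G) (redSet G Q)) (hQ : IsHeckeClass n Q)
    (ha : a ∈ G) (hdet : (a : Matrix (Fin 2) (Fin 2) (ZMod N)).det = n)
    (hσ : mapGL (ZMod N) (σ : SL(2, ℤ)) = adjGL a * a⁻¹) (k : ℤ) :
    (diamond G k (QuotientGroup.mk σ)).toLinearMap ∘ₗ hecke hΔ k =
      hecke hΔ k ∘ₗ (diamond G k (QuotientGroup.mk σ)).toLinearMap := by
  rw [diamond_comp_hecke hΔ (isHeckeSet_mul_right hΔ σ) k σ fun g => Iff.rfl,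
    hecke_comp_diamond hΔ (isHeckeSet_mul_right hΔ σ) k σ fun g =>
      (mem_iff_mul_right hQ ha hdet hσ g).trans (mem_iff_mul_left hQ ha hdet hσ g).symm]

/-- For `a ∈ G`, some `σ ∈ Γ_{𝔑(G)}` reduces to `det(a) a⁻²`. -/
lemma exists_mapGL_eq (ha : a ∈ G) :
    ∃ σ : Gam (nrm G), mapGL (ZMod N) (σ : SL(2, ℤ)) = adjGL a * a⁻¹ := by
  obtain ⟨γ, hγ⟩ := exists_red_eq N (adjGL a * a⁻¹ : GL (Fin 2) (ZMod N)) (by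
    have h : Matrix.GeneralLinearGroup.det (adjGL a * a⁻¹) = 1 := by
      have h1 : Matrix.GeneralLinearGroup.det (adjGL a) = Matrix.GeneralLinearGroup.det a := by
        apply Units.ext
        rw [Matrix.GeneralLinearGroup.val_det_apply, coe_adjGL, Matrix.det_adjugate]
        simp
      rw [map_mul, h1, map_inv, mul_inv_cancel]
    have := congrArg Units.val h
    simpa only [Matrix.GeneralLinearGroup.val_det_apply, Units.val_one] using this)
  have e : mapGL (ZMod N) γ = adjGL a * a⁻¹ := Units.ext (by rw [coe_mapGL_eq_red, hγ])
  refine ⟨⟨γ, ?_⟩, e⟩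
  rw [Gam, Subgroup.mem_comap, e, adjGL, mul_assoc]
  -- The scalar `det a` is central and `a⁻²` lies in `G`, so both normalize `G`.
  refine mul_mem (Subgroup.mem_normalizer_iff.mpr fun x => ?_)
    (Subgroup.le_normalizer (mul_mem (inv_mem ha) (inv_mem ha)))
  rw [scalar_mul_comm, mul_inv_cancel_right]

/-- The adjoint is `⟨σ⟩ T`, and `⟨σ⟩` commutes with `T`. -/
lemma isNormalOp_hecke_redSet (hΔ : IsHeckeSet (Gam G) (redSet G Q)) (hQ : IsHeckeClass n Q)
    (ha : a ∈ G) (hdet : (a : Matrix (Fin 2) (Fin 2) (ZMod N)).det = n) (k : ℤ) :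
    IsNormalOp (Gam G) k (hecke hΔ k) := by
  obtain ⟨σ, hσ⟩ := exists_mapGL_eq ha
  refine ⟨_, isAdjoint_hecke_redSet hΔ hQ ha hdet hσ k, ?_⟩
  rw [← LinearMap.comp_assoc, ← diamond_comp_hecke_comm hΔ hQ ha hdet hσ k]

end

lemma hecke_congr {Γ : Subgroup SL(2, ℤ)} [Γ.FiniteIndex] {Δ Δ' : Set (GL (Fin 2) ℚ)}
    (hΔ : IsHeckeSet Γ Δ) (hΔ' : IsHeckeSet Γ Δ') (h : Δ = Δ') (k : ℤ) :
    hecke hΔ k = hecke hΔ' k := by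
  subst h
  rfl

lemma isNormalOp_diamond {N : ℕ} [NeZero N] (G : Subgroup (GL (Fin 2) (ZMod N))) (k : ℤ)
    (q : Gam (nrm G) ⧸ GamIn G) : IsNormalOp (Gam G) k (diamond G k q).toLinearMap := by
  refine ⟨_, isAdjoint_diamond G k q, ?_⟩
  ext1 f
  simp

/-! ### The Petersson inner product -/

section

variable (Γ : Subgroup SL(2, ℤ)) [Γ.FiniteIndex] (k : ℤ)

lemma integral_wt_one_pos : 0 < ∫ τ, wt Γ τ := by
  have h := integral_wt_smul Γ (φ := fun _ => 1) measurable_const (C := 1) (by simp)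
  have h1 : ∫ τ, wt Γ τ • (1 : ℂ) = ((∫ τ, wt Γ τ : ℝ) : ℂ) := by
    rw [← integral_complex_ofReal]
    simp
  have h2 : ∑ q : SL(2, ℤ) ⧸ Γ, ∫ τ in (𝒟 : Set ℍ), (1 : ℂ) =
      ((Fintype.card (SL(2, ℤ) ⧸ Γ) * (volume (𝒟 : Set ℍ)).toReal : ℝ) : ℂ) := by
    simp [Measure.real]
  rw [h1, h2, Complex.ofReal_inj] at h
  rw [h]
  have := ENNReal.toReal_pos volume_fd_pos.ne' volume_fd_lt_top.ne
  have : (0 : ℝ) < Fintype.card (SL(2, ℤ) ⧸ Γ) := by exact_mod_cast Fintype.card_pos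
  positivity

lemma vol_eq : vol Γ = ((signIndex Γ : ℝ)⁻¹ * ∫ τ, wt Γ τ : ℝ) := by
  have h := integralX_eq Γ (φ := fun _ => 1) measurable_const (C := 1) (by simp) (by simp)
  rw [vol, h]
  push_cast
  rw [← integral_complex_ofReal]
  simp

lemma vol_ne_zero : vol Γ ≠ 0 := by
  rw [vol_eq]
  have h := (integral_wt_one_pos Γ).ne'
  have h1 := signIndex_ne_zero Γ
  exact_mod_cast mul_ne_zero (inv_ne_zero (by exact_mod_cast h1)) h

/-- The positive constant relating the Petersson product to the weighted integral over `ℍ`. -/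
def petConst : ℝ := ((signIndex Γ : ℝ)⁻¹ * ∫ τ, wt Γ τ)⁻¹ * (signIndex Γ : ℝ)⁻¹

lemma petConst_pos : 0 < petConst Γ := by
  have h := integral_wt_one_pos Γ
  have h1 : (0 : ℝ) < signIndex Γ := by exact_mod_cast Nat.pos_of_ne_zero (signIndex_ne_zero Γ)
  unfold petConst
  positivity

variable {Γ k}

lemma peterssonInner_eq_petConst (f g : SCusp Γ k) :
    peterssonInner Γ k f g = petConst Γ * ∫ τ, wt Γ τ • integrand k f g τ := by
  rw [peterssonInner_eq, vol_eq, petConst]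
  push_cast
  ring

lemma integrable_wt_integrand (f g : SCusp Γ k) :
    Integrable fun τ => wt Γ τ • integrand k f g τ := by
  obtain ⟨C, hC⟩ := exists_bound_integrand f g
  exact integrable_wt_smul Γ (continuous_integrand (continuous_cusp f)
    (continuous_cusp g)).measurable hC

lemma peterssonInner_conj_symm (f g : SCusp Γ k) :
    conj (peterssonInner Γ k f g) = peterssonInner Γ k g f := by
  rw [peterssonInner_eq_petConst, peterssonInner_eq_petConst, map_mul, Complex.conj_ofReal,
    ← integral_wt_integrand_symm]

lemma peterssonInner_add_right (f g h : SCusp Γ k) :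
    peterssonInner Γ k f (g + h) = peterssonInner Γ k f g + peterssonInner Γ k f h := by
  simp only [peterssonInner_eq_petConst]
  rw [← mul_add, ← integral_add (integrable_wt_integrand f g) (integrable_wt_integrand f h)]
  congr 2
  ext τ
  simp only [integrand, _root_.add_apply, map_add, Complex.real_smul]
  ring

lemma peterssonInner_smul_right (f g : SCusp Γ k) (r : ℂ) :
    peterssonInner Γ k f (r • g) = conj r * peterssonInner Γ k f g := by
  simp only [peterssonInner_eq_petConst]
  rw [mul_left_comm, ← integral_const_mul (conj r)]
  refine congrArg (fun z : ℂ => (petConst Γ : ℂ) * z)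
    (integral_congr_ae (Filter.Eventually.of_forall fun τ => ?_))
  simp only [integrand, _root_.smul_apply, smul_eq_mul, map_mul, Complex.real_smul]
  ring

lemma integrand_self (f : ℍ → ℂ) (τ : ℍ) :
    integrand k f f τ = (‖f τ‖ ^ 2 * τ.im ^ k : ℝ) := by
  rw [integrand, Complex.mul_conj, Complex.normSq_eq_norm_sq]
  push_cast
  rfl

lemma peterssonInner_self (f : SCusp Γ k) :
    peterssonInner Γ k f f = (petConst Γ * ∫ τ, wt Γ τ * (‖f τ‖ ^ 2 * τ.im ^ k) : ℝ) := by
  rw [peterssonInner_eq_petConst, Complex.ofReal_mul, ← integral_complex_ofReal]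
  simp only [integrand_self, Complex.real_smul, Complex.ofReal_mul]

lemma wt_mul_norm_nonneg (f : SCusp Γ k) (τ : ℍ) : 0 ≤ wt Γ τ * (‖f τ‖ ^ 2 * τ.im ^ k) := by
  have := wt_nonneg Γ τ
  have := τ.im_pos
  positivity

/-- The integrand `wt Γ · |f|² · Im^k` vanishes almost everywhere, and so do its `Γ`-translates. As
the translated weights sum to 2, they cannot all vanish, so `f = 0` almost everywhere and then
everywhere by continuity. -/
lemma eq_zero_of_peterssonInner_self (f : SCusp Γ k) (h : peterssonInner Γ k f f = 0) :
    f = 0 := by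
  rw [peterssonInner_self, Complex.ofReal_eq_zero, mul_eq_zero,
    or_iff_right (petConst_pos Γ).ne'] at h
  have hint : Integrable fun τ => wt Γ τ * (‖f τ‖ ^ 2 * τ.im ^ k) := by
    refine (integrable_wt_integrand f f).re.congr (Filter.Eventually.of_forall fun τ => ?_)
    simp only [integrand_self, Complex.real_smul, ← Complex.ofReal_mul]
    exact Complex.ofReal_re _
  rw [integral_eq_zero_iff_of_nonneg (wt_mul_norm_nonneg f) hint] at h
  have h1 : ∀ᵐ τ : ℍ, ∀ γ : Γ, wt Γ ((γ : SL(2, ℤ)) • τ) = 0 ∨ f τ = 0 := by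
    rw [ae_all_iff]
    intro γ
    have h2 := (measurePreserving_smul (γ : SL(2, ℤ))
      (volume : Measure ℍ)).quasiMeasurePreserving.ae h
    filter_upwards [h2] with τ hτ
    have h3 := integrand_smul_mem f f γ.2 τ
    rw [integrand_self, integrand_self, Complex.ofReal_inj] at h3
    simp only [Pi.zero_apply] at hτ
    rw [h3, mul_eq_zero] at hτ
    refine hτ.imp_right fun h4 => ?_
    have := (zpow_pos τ.im_pos k).ne'
    simpa [this] using h4
  have h2 : ∀ᵐ τ : ℍ, f τ = 0 := by
    filter_upwards [h1, ae_hasSum_wt Γ] with τ h3 h4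
    by_contra h5
    have h6 : (fun γ : Γ => wt Γ ((γ : SL(2, ℤ)) • τ)) = fun _ => 0 :=
      funext fun γ => (h3 γ).resolve_right h5
    rw [h6] at h4
    exact two_ne_zero (h4.unique hasSum_zero)
  have h3 : (f : ℍ → ℂ) = fun _ => 0 :=
    Measure.eq_of_ae_eq (μ := volume) h2 (continuous_cusp f) continuous_const
  ext τ
  exact congrFun h3 τ

variable (Γ k)

/-- The arguments are swapped because `InnerProductSpace.Core` is conjugate linear in the first
variable. -/
lemma exists_core_inner_eq : ∃ c : InnerProductSpace.Core ℂ (SCusp Γ k),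
    ∀ f g : SCusp Γ k, c.inner g f = peterssonInner Γ k f g :=
  ⟨{  inner := fun g f => peterssonInner Γ k f g
      conj_inner_symm := fun f g => peterssonInner_conj_symm f g
      re_inner_nonneg := fun f => by
        rw [peterssonInner_self]
        exact mul_nonneg (petConst_pos Γ).le (integral_nonneg (wt_mul_norm_nonneg f))
      add_left := fun f g h => peterssonInner_add_right h f g
      smul_left := fun f g r => peterssonInner_smul_right g f r
      definite := eq_zero_of_peterssonInner_self }, fun _ _ => rfl⟩

lemma integrableOn_integrand_smul (f g : SCusp Γ k) (γ : SL(2, ℤ)) :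
    IntegrableOn (fun τ : ℍ => integrand k f g (γ • τ)) 𝒟 := by
  obtain ⟨C, hC⟩ := exists_bound_integrand f g
  exact Measure.integrableOn_of_bounded (M := C) volume_fd_lt_top.ne
    ((continuous_integrand (continuous_cusp f) (continuous_cusp g)).measurable.comp
      (measurable_smul_SL2Z γ)).aestronglyMeasurable (Filter.Eventually.of_forall fun τ => hC _)

end

/-! ### Integral matrices with prescribed determinant and reduction -/

lemma mapGL_eq_of_red_eq {N : ℕ} {p : ℕ} {a : GL (Fin 2) (ZMod N)}
    (hdet : (a : Matrix (Fin 2) (Fin 2) (ZMod N)).det = p) {σ : SL(2, ℤ)} :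
    mapGL (ZMod N) σ = adjGL a * a⁻¹ ↔ red N σ =
      (p : ZMod N) • ((a⁻¹ ^ 2 : GL (Fin 2) (ZMod N)) : Matrix (Fin 2) (Fin 2) (ZMod N)) := by
  have h : ((adjGL a * a⁻¹ : GL (Fin 2) (ZMod N)) : Matrix (Fin 2) (Fin 2) (ZMod N)) =
      (p : ZMod N) • ((a⁻¹ ^ 2 : GL (Fin 2) (ZMod N)) : Matrix (Fin 2) (Fin 2) (ZMod N)) := by
    rw [adjGL, mul_assoc, ← sq, Units.val_mul]
    have h1 : ((Matrix.GeneralLinearGroup.scalar (Fin 2) (Matrix.GeneralLinearGroup.det a) :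
        GL (Fin 2) (ZMod N)) : Matrix (Fin 2) (Fin 2) (ZMod N)) = (p : ZMod N) • 1 := by
      rw [← hdet]
      ext i j
      simp [Matrix.GeneralLinearGroup.scalar, Matrix.one_apply, Matrix.diagonal_apply]
    rw [h1, smul_mul_assoc, one_mul]
  rw [← h, ← coe_mapGL_eq_red, Units.ext_iff]

/-- With `a ∈ G` of determinant `n`, the matrix `diag(1, n)⁻¹ a` over `ℤ/N` has determinant 1 and
lifts to `SL₂(ℤ)`; multiplying the lift by `diag(1, n)` gives the matrix. -/
lemma exists_det_eq_redMem {N : ℕ} [NeZero N] {G : Subgroup (GL (Fin 2) (ZMod N))} {n : ℕ}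
    (h : InDet G n) : ∃ A : Matrix (Fin 2) (Fin 2) ℤ, A.det = n ∧ RedMem G A := by
  obtain ⟨a, ha, hdet⟩ := h
  have hu : IsUnit (n : ZMod N) := hdet ▸ (Matrix.isUnit_iff_isUnit_det _).mp a.isUnit
  obtain ⟨u, hu⟩ := hu
  obtain ⟨γ, hγ⟩ := exists_red_eq N (!![1, 0; 0, ((u⁻¹ : (ZMod N)ˣ) : ZMod N)] *
    (a : Matrix (Fin 2) (Fin 2) (ZMod N))) (by
      rw [Matrix.det_mul, hdet, Matrix.det_fin_two_of, ← hu]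
      simp)
  refine ⟨!![1, 0; 0, (n : ℤ)] * γ, by
    rw [Matrix.det_mul, det_coe, Matrix.det_fin_two_of]; simp, a, ha, ?_⟩
  rw [red_mul, hγ, ← mul_assoc]
  have : red N !![1, 0; 0, (n : ℤ)] * !![1, 0; 0, ((u⁻¹ : (ZMod N)ˣ) : ZMod N)] = 1 := by
    ext i j
    fin_cases i <;> fin_cases j <;> simp [red, Matrix.mul_apply, ← hu]
  rw [this, one_mul]

end

end HeckeAdj

theorem mainTheorem7 (N : ℕ) [NeZero N] (G : Subgroup (GL (Fin 2) (ZMod N))) (k : ℤ) :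
    -- the Petersson integrals converge and define an inner product on `S_k(Γ_G)`
    vol (Gam G) ≠ 0 ∧
    (∀ (f g : SCusp (Gam G) k) (γ : SL(2, ℤ)),
      IntegrableOn (fun τ : ℍ => integrand k f g (γ • τ)) 𝒟) ∧
    (∃ c : InnerProductSpace.Core ℂ (SCusp (Gam G) k),
      ∀ f g : SCusp (Gam G) k, c.inner g f = peterssonInner (Gam G) k f g) ∧
    -- diamond operators
    (∀ q : Gam (nrm G) ⧸ GamIn G,
      IsAdjoint (Gam G) k (diamond G k q).toLinearMap (diamond G k q).symm.toLinearMap ∧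
      IsNormalOp (Gam G) k (diamond G k q).toLinearMap) ∧
    -- Hecke operators at primes
    (∀ p : ℕ, p.Prime → InDet G p →
      (∃ A : Matrix (Fin 2) (Fin 2) ℤ, A.det = p ∧ RedMem G A) ∧
      ∀ (A : Matrix (Fin 2) (Fin 2) ℤ) (hA : 0 < A.det) (a : GL (Fin 2) (ZMod N)),
        A.det = p → a ∈ G → (a : Matrix (Fin 2) (Fin 2) (ZMod N)) = red N A →
          heckeDC G k A hA = heckeT G k p ∧
          (∃ σ : Gam (nrm G), red N (σ : SL(2, ℤ)) =
            (p : ZMod N) • ((a⁻¹ ^ 2 : GL (Fin 2) (ZMod N)) : Matrix (Fin 2) (Fin 2) (ZMod N))) ∧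
          ∀ σ : Gam (nrm G), red N (σ : SL(2, ℤ)) =
            (p : ZMod N) • ((a⁻¹ ^ 2 : GL (Fin 2) (ZMod N)) : Matrix (Fin 2) (Fin 2) (ZMod N)) →
              IsAdjoint (Gam G) k (heckeT G k p)
                ((diamond G k (QuotientGroup.mk σ)).toLinearMap ∘ₗ heckeT G k p)) ∧
    -- normality of the Hecke operators `T_n` with `n ∈ det(G)`
    (∀ n : ℕ, 0 < n → InDet G n → IsNormalOp (Gam G) k (heckeT G k n)) ∧
    (∀ (A : Matrix (Fin 2) (Fin 2) ℤ) (hA : 0 < A.det), RedMem G A →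
      IsNormalOp (Gam G) k (heckeDC G k A hA)) := by
  refine ⟨vol_ne_zero _, integrableOn_integrand_smul _ k, exists_core_inner_eq _ k,
    fun q => ⟨isAdjoint_diamond G k q, isNormalOp_diamond G k q⟩, ?_, ?_, ?_⟩
  · intro p hp hpG
    refine ⟨exists_det_eq_redMem hpG, fun A hA a hAp ha haA => ?_⟩
    have hdet : (a : Matrix (Fin 2) (Fin 2) (ZMod N)).det = p := by
      rw [haA, red_det, hAp, Int.cast_natCast]
    refine ⟨hecke_congr _ _ ?_ k, ?_, fun σ hσ => ?_⟩
    · rw [dcoset_eq_redSet hA ⟨a, ha, haA⟩]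
      ext g
      exact ⟨fun ⟨B, hB, h⟩ => ⟨B, hB.det_eq.trans hAp, h⟩,
        fun ⟨B, hB, h⟩ => ⟨B, slEquiv_of_det_prime hp hAp hB, h⟩⟩
    · obtain ⟨σ, hσ⟩ := exists_mapGL_eq ha
      exact ⟨σ, (mapGL_eq_of_red_eq hdet).mp hσ⟩
    · exact isAdjoint_hecke_redSet (isHeckeSet_DeltaN G p) (isHeckeClass_det p) ha hdet
        ((mapGL_eq_of_red_eq hdet).mpr hσ) k
  · rintro n - ⟨a, ha, hdet⟩
    exact isNormalOp_hecke_redSet (isHeckeSet_DeltaN G n) (isHeckeClass_det n) ha hdet k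
  · rintro A hA hAG
    have hΔ := isHeckeSet_dcoset (Gam G) A hA
    -- The double coset becomes a congruence set whose defining class is closed under adjugates.
    rw [heckeDC, hecke_congr hΔ (dcoset_eq_redSet hA hAG ▸ hΔ) (dcoset_eq_redSet hA hAG) k]
    obtain ⟨a, ha, haA⟩ := hAG
    refine isNormalOp_hecke_redSet _ (isHeckeClass_slEquiv A hA) ha ?_ k
    rw [haA, red_det, ← Int.cast_natCast, Int.toNat_of_nonneg hA.le]
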